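/- Let $\Lambda$ be an artin algebra, $n\ge 1$, and let $\mathcal M$ be an $n$-cluster tilting subcategory of the category $\mathrm{mod}\text{-}\Lambda$ of finitely generated right $\Lambda$-modules, i.e. a functorially finite, generating and cogenerating full subcategory with $$\mathcal M=\{Y\mid \mathrm{Ext}^i_\Lambda(\mathcal M,Y)=0,\ 0<i<n\}=\{X\mid \mathrm{Ext}^i_\Lambda(X,\mathcal M)=0,\ 0<i<n\}.$$ Let $\mathcal S(\mathcal M)$ (resp. $\mathcal F(\mathcal M)$) be the full subcategory of the morphism category of $\mathcal M$ on the morphisms that are monomorphisms (resp. epimorphisms) in $\mathrm{mod}\text{-}\Lambda$. Let $\mathrm{mod}\text{-}\underline{\mathcal M}$ be the category of finitely presented additive contravariant functors $\mathcal M\to\mathcal Ab$ vanishing on projective modules, and $\overline{\mathcal M}\text{-}\mathrm{mod}$ the category of finitely presented additive covariant functors $\mathcal M\to\mathcal Ab$ vanishing on injective modules. Let $\mathcal V\subseteq\mathcal S(\mathcal M)$ be generated by the objects $(M\xrightarrow{1}M)$ and $(0\to M)$, and $\mathcal V'\subseteq\mathcal F(\mathcal M)$ by the objects $(M\xrightarrow{1}M)$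 and $(M\to 0)$, with $M\in\mathcal M$; a quotient by $\mathcal V$ or $\mathcal V'$ is the quotient by the ideal of morphisms that factor through a finite direct sum of such objects. A sequence $0\to M^0\to M^1\to\cdots\to M^{n+1}\to 0$ in $\mathcal M$ is $n$-exact if for all $X\in\mathcal M$ the sequences $0\to\mathcal M(X,M^0)\to\cdots\to\mathcal M(X,M^{n+1})$ and $0\to\mathcal M(M^{n+1},X)\to\cdots\to\mathcal M(M^0,X)$ are exact. (1) The functor $\Theta:\mathcal F(\mathcal M)\to\mathrm{mod}\text{-}\underline{\mathcal M}$, $(M_1\xrightarrow{f}M_2)\mapsto\mathrm{Coker}\big(\mathcal M(-,M_1)\xrightarrow{\mathcal M(-,f)}\mathcal M(-,M_2)\big)$, is additive, full, dense and objective (every morphism killed by $\Theta$ factors through an object killed by $\Theta$), and it induces an equivalence $\mathcal F(\mathcal M)/\mathcal V'\simeq\mathrm{mod}\text{-}\underline{\mathcal M}$. (2) Up to isomorphism in the morphism category, every object of $\mathcal S(\mathcal M)$ (resp. $\mathcal F(\mathcal M)$) is the first (resp. last) map of an $n$-exact sequence in $\mathcal M$, and morphisms between such objects extend to morphisms of $n$-exact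 sequences. Consequently there are functors $\Psi:\mathcal S(\mathcal M)\to\mathrm{mod}\text{-}\underline{\mathcal M}$ and (contravariant) $\Psi':\mathcal F(\mathcal M)\to\overline{\mathcal M}\text{-}\mathrm{mod}$ such that, naturally in the $n$-exact sequence $0\to M^0\xrightarrow{u^0}M^1\to\cdots\to M^n\xrightarrow{u^n}M^{n+1}\to0$, one has $\Psi(u^0)\cong\mathrm{Coker}\,\mathcal M(-,u^n)$ and $\Psi'(u^n)\cong\mathrm{Coker}\,\mathcal M(u^0,-)$. (3) $\Psi$, $\Theta$ and $\Psi'$ induce equivalences of abelian categories $$\mathcal S(\mathcal M)/\mathcal V\simeq\mathrm{mod}\text{-}\underline{\mathcal M}\simeq(\overline{\mathcal M}\text{-}\mathrm{mod})^{op}\simeq\mathcal F(\mathcal M)/\mathcal V'.$$ In particular $\Sigma=\Psi'\circ\Theta^{-1}:\mathrm{mod}\text{-}\underline{\mathcal M}\to\overline{\mathcal M}\text{-}\mathrm{mod}$ is a duality, where $\Theta^{-1}$ denotes a quasi-inverse of the equivalence induced by $\Theta$, and $\Psi'$ the induced functor on $\mathcal F(\mathcal M)/\mathcal V'$. -/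

import Mathlib

open CategoryTheory Limits Opposite

universe u v u₁ w

/-- An artin algebra: a ring which is a finitely generated module over some commutative artinian
ring acting through the centre. (The base ring may be replaced by its image in `Λ`, so taking it in
the same universe is no restriction.) -/
class IsArtinAlgebra (Λ : Type u) [Ring Λ] : Prop where
  exists_base : ∃ (R : Type u) (_ : CommRing R) (_ : IsArtinianRing R) (_ : Algebra R Λ),
    Module.Finite R Λ

/-- An artin algebra is right noetherian. -/
instance IsArtinAlgebra.isNoetherianRing_op (Λ : Type u) [Ring Λ] [h : IsArtinAlgebra Λ] :
    IsNoetherianRing Λᵐᵒᵖ := by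
  obtain ⟨R, _, _, _, _⟩ := h.exists_base
  have : Module.Finite R Λᵐᵒᵖ := Module.Finite.equiv (MulOpposite.opLinearEquiv R)
  exact isNoetherian_of_tower R (inferInstance : IsNoetherian R Λᵐᵒᵖ)

/-- `mod-Λ`: the category of finitely generated right `Λ`-modules. -/
abbrev FGRightMod (Λ : Type u) [Ring Λ] : Type (u + 1) := FGModuleCat.{u} Λᵐᵒᵖ

noncomputable section

namespace HigherAuslander

/-! ### Objective functors, ideals and quotient categories -/

section Additive

variable {C : Type u} [Category.{v} C] [Preadditive C]

/-- A functor `F` is objective if every morphism killed by `F` factors through an object killed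
by `F`. -/
def IsObjective {D : Type u₁} [Category.{w} D] [Preadditive D] (F : C ⥤ D) : Prop :=
  ∀ ⦃X Y : C⦄ (f : X ⟶ Y), F.map f = 0 →
    ∃ (K : C) (a : X ⟶ K) (b : K ⟶ Y), IsZero (F.obj K) ∧ a ≫ b = f

/-- The homsets of the ideal `⟨K⟩`: all finite sums of morphisms factoring through objects in `K`
(when finite direct sums exist, these are the morphisms factoring through a finite direct sum of
objects in `K`). -/
def idealHom (K : ObjectProperty C) (X Y : C) : AddSubgroup (X ⟶ Y) :=
  AddSubgroup.closure {f | ∃ (Z : C) (a : X ⟶ Z) (b : Z ⟶ Y), K Z ∧ a ≫ b = f}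

/-- Congruence modulo the ideal `⟨K⟩`. -/
def idealRel (K : ObjectProperty C) : HomRel C := fun X Y f g => f - g ∈ idealHom K X Y

lemma comp_mem_idealHom (K : ObjectProperty C) {X Y Z : C} (f : X ⟶ Y) {g : Y ⟶ Z}
    (hg : g ∈ idealHom K Y Z) : f ≫ g ∈ idealHom K X Z := by
  refine AddSubgroup.closure_induction (p := fun g _ => f ≫ g ∈ idealHom K X Z)
    ?_ ?_ ?_ ?_ hg
  · rintro _ ⟨W, a, b, hW, rfl⟩
    exact AddSubgroup.subset_closure ⟨W, f ≫ a, b, hW, by simp⟩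
  · simp
  · intro _ _ _ _ h₁ h₂
    rw [Preadditive.comp_add]
    exact add_mem h₁ h₂
  · intro _ _ h
    rw [Preadditive.comp_neg]
    exact neg_mem h

lemma mem_idealHom_comp (K : ObjectProperty C) {X Y Z : C} {f : X ⟶ Y} (g : Y ⟶ Z)
    (hf : f ∈ idealHom K X Y) : f ≫ g ∈ idealHom K X Z := by
  refine AddSubgroup.closure_induction (p := fun f _ => f ≫ g ∈ idealHom K X Z)
    ?_ ?_ ?_ ?_ hf
  · rintro _ ⟨W, a, b, hW, rfl⟩
    exact AddSubgroup.subset_closure ⟨W, a, b ≫ g, hW, by simp⟩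
  · simp
  · intro _ _ _ _ h₁ h₂
    rw [Preadditive.add_comp]
    exact add_mem h₁ h₂
  · intro _ _ h
    rw [Preadditive.neg_comp]
    exact neg_mem h

instance (K : ObjectProperty C) : Congruence (idealRel K) where
  comp_left f _ _ h := by
    simpa [idealRel, Preadditive.comp_sub] using comp_mem_idealHom K f h
  comp_right g h := by
    simpa [idealRel, Preadditive.sub_comp] using mem_idealHom_comp K g h
  equivalence :=
    { refl := fun f => by simp [idealRel]
      symm := fun {f g} h => by simpa [idealRel] using neg_mem h
      trans := fun {f g h} h₁ h₂ => by simpa [idealRel] using add_mem h₁ h₂ }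

/-- The quotient category `C/⟨K⟩`. -/
abbrev QuotientByIdeal (K : ObjectProperty C) : Type u := Quotient (idealRel K)

instance (K : ObjectProperty C) : Preadditive (QuotientByIdeal K) :=
  Quotient.preadditive (idealRel K) (by
    intro X Y f₁ f₂ g₁ g₂ h₁ h₂
    have := add_mem h₁ h₂
    simp only [idealRel]
    convert this using 1
    abel)

/-- The canonical functor `C ⥤ C/⟨K⟩`. -/
abbrev toQuotient (K : ObjectProperty C) : C ⥤ QuotientByIdeal K := Quotient.functor (idealRel K)

/-- A preadditive category is abelian for its given additive structure. -/
def IsAbelianCategory (C : Type u) [Category.{v} C] [P : Preadditive C] : Prop :=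
  ∃ a : Abelian C, a.toPreadditive = P

end Additive

/-! ### `n`-cluster tilting subcategories -/

section ClusterTilting

variable {A : Type u} [Category.{v} A] (M : ObjectProperty A)

def IsContravariantlyFinite : Prop :=
  ∀ X : A, ∃ (Y : A) (p : Y ⟶ X), M Y ∧ ∀ (Z : A) (f : Z ⟶ X), M Z → ∃ g : Z ⟶ Y, g ≫ p = f

def IsCovariantlyFinite : Prop :=
  ∀ X : A, ∃ (Y : A) (i : X ⟶ Y), M Y ∧ ∀ (Z : A) (f : X ⟶ Z), M Z → ∃ g : Y ⟶ Z, i ≫ g = f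

def IsGenerating : Prop := ∀ X : A, ∃ (Y : A) (p : Y ⟶ X), M Y ∧ Epi p

def IsCogenerating : Prop := ∀ X : A, ∃ (Y : A) (i : X ⟶ Y), M Y ∧ Mono i

variable [Abelian A]

/-- `Extⁱ(X, Y) = 0` for all `0 < i < n`. -/
def ExtVanish (n : ℕ) (X Y : A) : Prop :=
  letI := HasExt.standard A
  ∀ i : ℕ, 0 < i → i < n → Subsingleton (Abelian.Ext X Y i)

/-- `n`-cluster tilting subcategories of an abelian category. -/
structure IsNClusterTilting (n : ℕ) : Prop where
  contravariantlyFinite : IsContravariantlyFinite M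
  covariantlyFinite : IsCovariantlyFinite M
  generating : IsGenerating M
  cogenerating : IsCogenerating M
  mem_iff_right : ∀ Y : A, M Y ↔ ∀ X : A, M X → ExtVanish n X Y
  mem_iff_left : ∀ X : A, M X ↔ ∀ Y : A, M Y → ExtVanish n X Y

end ClusterTilting

/-! ### `n`-exact sequences -/

/-- A sequence `0 ⟶ M⁰ ⟶ M¹ ⟶ ⋯ ⟶ Mⁿ⁺¹ ⟶ 0` in `C` is `n`-exact if for all `X` in `C` both
`0 ⟶ C(X, M⁰) ⟶ ⋯ ⟶ C(X, Mⁿ⁺¹)` and `0 ⟶ C(Mⁿ⁺¹, X) ⟶ ⋯ ⟶ C(M⁰, X)` are exact. -/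
structure IsNExact {C : Type u} [Category.{v} C] [Preadditive C] {n : ℕ}
    (S : ComposableArrows C (n + 1)) : Prop where
  zero : ∀ (i : ℕ) (hi : i + 2 ≤ n + 1), S.map' i (i + 1) ≫ S.map' (i + 1) (i + 2) = 0
  mono : Mono (S.map' 0 1)
  lift : ∀ (i : ℕ) (hi : i + 2 ≤ n + 1) (X : C) (g : X ⟶ S.obj' (i + 1)),
    g ≫ S.map' (i + 1) (i + 2) = 0 → ∃ h : X ⟶ S.obj' i, h ≫ S.map' i (i + 1) = g
  epi : Epi (S.map' n (n + 1))
  desc : ∀ (i : ℕ) (hi : i + 2 ≤ n + 1) (X : C) (g : S.obj' (i + 1) ⟶ X),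
    S.map' i (i + 1) ≫ g = 0 → ∃ h : S.obj' (i + 2) ⟶ X, S.map' (i + 1) (i + 2) ≫ h = g

/-- The category of `n`-exact sequences in `C`; morphisms are commutative ladders. -/
abbrev NExactSeq (C : Type u) [Category.{v} C] [Preadditive C] (n : ℕ) :=
  ObjectProperty.FullSubcategory fun S : ComposableArrows C (n + 1) => IsNExact S

/-! ### Categories of monomorphisms and epimorphisms -/

section Main

variable {A : Type u} [Category.{v} A] [Abelian A] (M : ObjectProperty A)

/-- `S(M)`: the full subcategory of the morphism category of `M` on the morphisms that are
monomorphisms in the ambient abelian category. -/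
abbrev MonoCat :=
  ObjectProperty.FullSubcategory fun f : Arrow M.FullSubcategory => Mono (M.ι.map f.hom)

/-- `F(M)`: the full subcategory of the morphism category of `M` on the morphisms that are
epimorphisms in the ambient abelian category. -/
abbrev EpiCat :=
  ObjectProperty.FullSubcategory fun f : Arrow M.FullSubcategory => Epi (M.ι.map f.hom)

/-- The generators of `V`: objects of `S(M)` isomorphic to `(N ⟶ N, identity)` or `(0 ⟶ N)`. -/
def genV : ObjectProperty (MonoCat M) := fun f => IsIso f.obj.hom ∨ IsZero f.obj.left

/-- The generators of `V'`: objects of `F(M)` isomorphic to `(N ⟶ N, identity)` or `(N ⟶ 0)`. -/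
def genV' : ObjectProperty (EpiCat M) := fun f => IsIso f.obj.hom ∨ IsZero f.obj.right

variable {M}

lemma mono_ι_map (hM : IsGenerating M) {X Y : M.FullSubcategory} (f : X ⟶ Y) [Mono f] :
    Mono (M.ι.map f) := by
  refine Preadditive.mono_of_cancel_zero _ fun {Z} g hg => ?_
  obtain ⟨W, p, hW, hp⟩ := hM Z
  have h : (M.homMk (X := ⟨W, hW⟩) (Y := X) (p ≫ g)) ≫ f = 0 := by
    apply M.ι.map_injective
    simpa using congrArg (fun t => p ≫ t) hg
  have h' := congrArg M.ι.map (zero_of_comp_mono f h)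
  rw [← cancel_epi p, comp_zero]
  simpa using h'

lemma epi_ι_map (hM : IsCogenerating M) {X Y : M.FullSubcategory} (f : X ⟶ Y) [Epi f] :
    Epi (M.ι.map f) := by
  refine Preadditive.epi_of_cancel_zero _ fun {Z} g hg => ?_
  obtain ⟨W, p, hW, hp⟩ := hM Z
  have h : f ≫ (M.homMk (X := Y) (Y := ⟨W, hW⟩) (g ≫ p)) = 0 := by
    apply M.ι.map_injective
    simpa using congrArg (fun t => t ≫ p) hg
  have h' := congrArg M.ι.map (zero_of_epi_comp f h)
  rw [← cancel_mono p, zero_comp]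
  simpa using h'

lemma mono_map_first (hM : IsGenerating M) {n : ℕ} (S : NExactSeq M.FullSubcategory n) :
    Mono (M.ι.map (S.obj.map' 0 1)) := by
  have := S.property.mono
  exact mono_ι_map hM _

lemma epi_map_last (hM : IsCogenerating M) {n : ℕ} (S : NExactSeq M.FullSubcategory n) :
    Epi (M.ι.map (S.obj.map' n (n + 1))) := by
  have := S.property.epi
  exact epi_ι_map hM _

/-- The first morphism of an `n`-exact sequence, as a functor to `S(M)`. -/
def firstMono (hM : IsGenerating M) (n : ℕ) : NExactSeq M.FullSubcategory n ⥤ MonoCat M where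
  obj S := ⟨Arrow.mk (S.obj.map' 0 1), mono_map_first hM S⟩
  map φ := ObjectProperty.homMk (Arrow.homMk (ComposableArrows.app' φ.hom 0)
    (ComposableArrows.app' φ.hom 1) (φ.hom.naturality _).symm)

/-- The last morphism of an `n`-exact sequence, as a functor to `F(M)`. -/
def lastEpi (hM : IsCogenerating M) (n : ℕ) : NExactSeq M.FullSubcategory n ⥤ EpiCat M where
  obj S := ⟨Arrow.mk (S.obj.map' n (n + 1)), epi_map_last hM S⟩
  map φ := ObjectProperty.homMk (Arrow.homMk (ComposableArrows.app' φ.hom n)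
    (ComposableArrows.app' φ.hom (n + 1)) (φ.hom.naturality _).symm)

/-! ### Finitely presented functors -/

variable (M)

/-- The objects of `mod-M̲`: additive functors `F : Mᵒᵖ ⥤ Ab` which are finitely presented, i.e.
there is an exact sequence `M(-, X) ⟶ M(-, Y) ⟶ F ⟶ 0`, and which vanish on the projective
objects. -/
structure IsStableRight (F : M.FullSubcategoryᵒᵖ ⥤ AddCommGrpCat.{v}) : Prop where
  additive : F.Additive
  fp : ∃ (X Y : M.FullSubcategory) (a : preadditiveYoneda.obj X ⟶ preadditiveYoneda.obj Y)
    (b : preadditiveYoneda.obj Y ⟶ F) (w : a ≫ b = 0), (ShortComplex.mk a b w).Exact ∧ Epi b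
  vanish : ∀ P : M.FullSubcategory, Projective P.obj → IsZero (F.obj (op P))

/-- The objects of `M̄-mod`: additive functors `F : M ⥤ Ab` which are finitely presented, i.e.
there is an exact sequence `M(X, -) ⟶ M(Y, -) ⟶ F ⟶ 0`, and which vanish on the injective
objects. -/
structure IsStableLeft (F : M.FullSubcategory ⥤ AddCommGrpCat.{v}) : Prop where
  additive : F.Additive
  fp : ∃ (X Y : M.FullSubcategory)
    (a : preadditiveCoyoneda.obj (op X) ⟶ preadditiveCoyoneda.obj (op Y))
    (b : preadditiveCoyoneda.obj (op Y) ⟶ F) (w : a ≫ b = 0),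
    (ShortComplex.mk a b w).Exact ∧ Epi b
  vanish : ∀ I : M.FullSubcategory, Injective I.obj → IsZero (F.obj I)

/-- `mod-M̲`, with natural transformations as morphisms. -/
abbrev StableRightMod := ObjectProperty.FullSubcategory (IsStableRight M)

/-- `M̄-mod`, with natural transformations as morphisms. -/
abbrev StableLeftMod := ObjectProperty.FullSubcategory (IsStableLeft M)

/-- An epimorphic image of an additive functor to abelian groups is additive. -/
lemma additive_of_epi {C : Type u} [Category.{v} C] [Preadditive C]
    {F G : C ⥤ AddCommGrpCat.{w}} [F.Additive] (p : F ⟶ G) [Epi p] : G.Additive where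
  map_add {X Y f g} := by
    rw [← cancel_epi (p.app X), Preadditive.comp_add, ← p.naturality, ← p.naturality,
      ← p.naturality, F.map_add, Preadditive.add_comp]

lemma isZero_of_epi_of_comp {F G H : AddCommGrpCat.{w}} (a : F ⟶ G) (b : G ⟶ H) [Epi a] [Epi b]
    (h : a ≫ b = 0) : IsZero H := by
  rw [IsZero.iff_id_eq_zero, ← cancel_epi b, ← cancel_epi a, comp_zero, comp_zero,
    Category.comp_id, h]

lemma isStableRight_cokernel (f : EpiCat M) :
    IsStableRight M (cokernel (preadditiveYoneda.map f.obj.hom)) where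
  additive := additive_of_epi (cokernel.π (preadditiveYoneda.map f.obj.hom))
  fp := ⟨_, _, preadditiveYoneda.map f.obj.hom, cokernel.π _, cokernel.condition _,
    ShortComplex.exact_cokernel _, inferInstance⟩
  vanish P hP := by
    have := f.property
    have : Projective (M.ι.obj P) := hP
    have : Epi ((preadditiveYoneda.map f.obj.hom).app (op P)) := by
      rw [AddCommGrpCat.epi_iff_surjective]
      intro (g : P ⟶ f.obj.right)
      refine ⟨M.homMk (Projective.factorThru (M.ι.map g) (M.ι.map f.obj.hom)), ?_⟩
      apply M.ι.map_injective
      exact Projective.factorThru_comp (M.ι.map g) (M.ι.map f.obj.hom)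
    refine isZero_of_epi_of_comp ((preadditiveYoneda.map f.obj.hom).app (op P))
      ((cokernel.π (preadditiveYoneda.map f.obj.hom)).app (op P)) ?_
    rw [← NatTrans.comp_app, cokernel.condition]
    rfl

lemma isStableLeft_cokernel (f : MonoCat M) :
    IsStableLeft M (cokernel (preadditiveCoyoneda.map f.obj.hom.op)) where
  additive := additive_of_epi (cokernel.π (preadditiveCoyoneda.map f.obj.hom.op))
  fp := ⟨_, _, preadditiveCoyoneda.map f.obj.hom.op, cokernel.π _, cokernel.condition _,
    ShortComplex.exact_cokernel _, inferInstance⟩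
  vanish I hI := by
    have := f.property
    have : Injective (M.ι.obj I) := hI
    have : Epi ((preadditiveCoyoneda.map f.obj.hom.op).app I) := by
      rw [AddCommGrpCat.epi_iff_surjective]
      intro (g : f.obj.left ⟶ I)
      refine ⟨M.homMk (Injective.factorThru (M.ι.map g) (M.ι.map f.obj.hom)), ?_⟩
      apply M.ι.map_injective
      exact Injective.comp_factorThru (M.ι.map g) (M.ι.map f.obj.hom)
    refine isZero_of_epi_of_comp ((preadditiveCoyoneda.map f.obj.hom.op).app I)
      ((cokernel.π (preadditiveCoyoneda.map f.obj.hom.op)).app I) ?_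
    rw [← NatTrans.comp_app, cokernel.condition]
    rfl

/-! ### The functors -/

/-- `Θ : F(M) ⥤ mod-M̲`, `(f : M₁ ⟶ M₂) ↦ Coker (M(-, f) : M(-, M₁) ⟶ M(-, M₂))`. -/
def Theta : EpiCat M ⥤ StableRightMod M :=
  ObjectProperty.lift _
    { obj := fun f => cokernel (preadditiveYoneda.map f.obj.hom)
      map := fun {f g} φ => cokernel.map _ _ (preadditiveYoneda.map φ.hom.left)
        (preadditiveYoneda.map φ.hom.right)
        (by rw [← Functor.map_comp, ← Functor.map_comp, Arrow.w])
      map_id := fun f => by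
        apply coequalizer.hom_ext
        simp
      map_comp := fun φ ψ => by
        apply coequalizer.hom_ext
        simp }
    (isStableRight_cokernel M)

/-- The contravariant functor from `S(M)` to `M̄-mod`,
`(f : M₁ ⟶ M₂) ↦ Coker (M(f, -) : M(M₂, -) ⟶ M(M₁, -))`. -/
def coTheta : MonoCat M ⥤ (StableLeftMod M)ᵒᵖ where
  obj f := op ⟨cokernel (preadditiveCoyoneda.map f.obj.hom.op), isStableLeft_cokernel M f⟩
  map {f g} φ := Quiver.Hom.op <| ObjectProperty.homMk <|
    cokernel.map _ _ (preadditiveCoyoneda.map φ.hom.right.op)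
      (preadditiveCoyoneda.map φ.hom.left.op)
      (by rw [← Functor.map_comp, ← Functor.map_comp, ← op_comp, ← op_comp, Arrow.w])
  map_id f := by
    apply Quiver.Hom.unop_inj
    ext1
    apply coequalizer.hom_ext
    simp
  map_comp φ ψ := by
    apply Quiver.Hom.unop_inj
    ext1
    apply coequalizer.hom_ext
    simp

variable {M}

/-- `Ψ : S(M) ⥤ mod-M̲` is the functor which sends a monomorphism `f`, embedded in an `n`-exact
sequence `0 ⟶ M₁ ⟶ M₂ ⟶ M¹ ⟶ ⋯ ⟶ Mⁿ ⟶ 0` with first map `f`, to the cokernel of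
`M(-, Mⁿ⁻¹) ⟶ M(-, Mⁿ)`, naturally with respect to morphisms of `n`-exact sequences. -/
def IsPsi (hM : IsGenerating M) (hM' : IsCogenerating M) (n : ℕ)
    (Ψ : MonoCat M ⥤ StableRightMod M) : Prop :=
  Nonempty (firstMono hM n ⋙ Ψ ≅ lastEpi hM' n ⋙ Theta M)

/-- `Ψ' : F(M) ⥤ (M̄-mod)ᵒᵖ` is the functor which sends an epimorphism `f`, embedded in an
`n`-exact sequence `0 ⟶ M¹ ⟶ M² ⟶ ⋯ ⟶ Mⁿ ⟶ M₁ ⟶ M₂ ⟶ 0` with last map `f`, to the cokernel of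
`M(M², -) ⟶ M(M¹, -)`, naturally with respect to morphisms of `n`-exact sequences. -/
def IsPsi' (hM : IsGenerating M) (hM' : IsCogenerating M) (n : ℕ)
    (Ψ' : EpiCat M ⥤ (StableLeftMod M)ᵒᵖ) : Prop :=
  Nonempty (lastEpi hM' n ⋙ Ψ' ≅ firstMono hM n ⋙ coTheta M)

end Main

end HigherAuslander

end

/-! The proof compares two cokernel functors through the category of `n`-exact sequences and their
ladders.

`Theta` is studied by generators and relations. The functor `Coker M(-, g)` is generated by the
class of the identity, with relations generated by `g`. So `Theta` is full, and it kills a morphism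
exactly when its right component factors through the target epimorphism (`Theta_map_eq_zero_iff`).
Such a morphism is a sum of one factoring through an identity object and one factoring through some
`N ⟶ 0`, so the kernel of `Theta` is the ideal of `genV'`. Density holds because a presented functor
vanishing on a projective that covers the generating object has an epimorphism as its relation. All
of this dualizes to `coTheta`, with monomorphisms and injectives.

Taking the first or the last map of an `n`-exact sequence is full, since ladders can be filled in
from either end. It is also dense: iterated left approximations of cokernels, starting from a
monomorphism, reach an object of `M` after `n` steps by dimension shifting in `Ext`
(`exists_isNExactFor`); the epimorphism case is the same construction in the opposite category. A
partial null-homotopy of a ladder moves from one place to the next, so its first component factors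
through the first map of the source if and only if its last component factors through the last map
of the target (`IsNExact.exists_homotopy_iff`). Hence `lastEpi ⋙ Theta` and `firstMono ⋙ coTheta`
are full and dense and identify the same morphisms, so their targets are equivalent. That
equivalence is `Σ`; `Ψ` and `Ψ'` are obtained from `coTheta` and `Theta` by composing with it.

Only `mod-M̲` has to be proved abelian. It is closed under kernels, cokernels and finite products in
the functor category, kernels being finitely presented because right approximations of pullbacks
give weak pullbacks in `M`; the other categories inherit the property.

Density of `Theta` and `coTheta` requires enough projectives and injectives in `mod-Λ`. For
injectives, the essential hull of a finitely generated module has its socle inside that module, and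
finiteness then climbs along the powers of the Jacobson radical. -/

noncomputable section

namespace HigherAuslander

/-! ### Descending functors along full and essentially surjective functors -/

section Descent

variable {N X Y : Type*} [Category* N] [Category* X] [Category* Y]

/-- A functor `G` which identifies all morphisms identified by a full and essentially surjective
functor `F` factors through `F`. -/
def descend (F : N ⥤ X) (G : N ⥤ Y) [F.Full] [F.EssSurj]
    (h : ∀ ⦃a b : N⦄ (f g : a ⟶ b), F.map f = F.map g → G.map f = G.map g) : X ⥤ Y where
  obj x := G.obj (F.objPreimage x)
  map {x y} f := G.map (F.preimage ((F.objObjPreimageIso x).hom ≫ f ≫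
    (F.objObjPreimageIso y).inv))
  map_id x := by
    rw [← G.map_id]
    apply h
    simp
  map_comp f g := by
    rw [← G.map_comp]
    apply h
    simp

variable (F : N ⥤ X) (G : N ⥤ Y) [F.Full] [F.EssSurj]
    (h : ∀ ⦃a b : N⦄ (f g : a ⟶ b), F.map f = F.map g → G.map f = G.map g)

/-- The image under `G` of an object is determined by its image under `F`. -/
def objPreimageObjIso (F : N ⥤ X) (G : N ⥤ Y) [F.Full] [F.EssSurj]
    (h : ∀ ⦃a b : N⦄ (f g : a ⟶ b), F.map f = F.map g → G.map f = G.map g) (a : N) :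
    G.obj (F.objPreimage (F.obj a)) ≅ G.obj a where
  hom := G.map (F.preimage (F.objObjPreimageIso (F.obj a)).hom)
  inv := G.map (F.preimage (F.objObjPreimageIso (F.obj a)).inv)
  hom_inv_id := by
    rw [← G.map_comp, ← G.map_id]
    apply h
    simp
  inv_hom_id := by
    rw [← G.map_comp, ← G.map_id]
    apply h
    simp

/-- The factorization of `descend`. -/
def compDescendIso : F ⋙ descend F G h ≅ G :=
  NatIso.ofComponents (objPreimageObjIso F G h)
    (fun f => by
      change G.map _ ≫ G.map _ = G.map _ ≫ G.map _
      rw [← G.map_comp, ← G.map_comp]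
      apply h
      simp)

lemma descend_full [G.Full] : (descend F G h).Full where
  map_surjective {x y} g := by
    obtain ⟨k, rfl⟩ := G.map_surjective g
    refine ⟨(F.objObjPreimageIso x).inv ≫ F.map k ≫ (F.objObjPreimageIso y).hom, ?_⟩
    apply h
    simp

lemma descend_essSurj [G.EssSurj] : (descend F G h).EssSurj where
  mem_essImage y :=
    ⟨F.obj (G.objPreimage y), ⟨(compDescendIso F G h).app _ ≪≫ G.objObjPreimageIso y⟩⟩

lemma descend_faithful
    (h' : ∀ ⦃a b : N⦄ (f g : a ⟶ b), G.map f = G.map g → F.map f = F.map g) :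
    (descend F G h).Faithful where
  map_injective {x y} f g hfg := by
    have := h' _ _ hfg
    simpa using this

/-- Two full and essentially surjective functors which identify the same morphisms have equivalent
targets. -/
lemma exists_equivalence_of_map_eq_iff [G.Full] [G.EssSurj]
    (h : ∀ ⦃a b : N⦄ (f g : a ⟶ b), F.map f = F.map g ↔ G.map f = G.map g) :
    ∃ e : X ≌ Y, Nonempty (F ⋙ e.functor ≅ G) := by
  have h₁ := fun a b (f g : a ⟶ b) => (h f g).1
  have := descend_full F G h₁
  have := descend_essSurj F G h₁
  have := descend_faithful F G h₁ (fun a b f g => (h f g).2)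
  have : (descend F G h₁).IsEquivalence := { }
  exact ⟨(descend F G h₁).asEquivalence, ⟨compDescendIso F G h₁⟩⟩

end Descent

/-! ### Quotients by ideals and transfer of abelianness -/

section QuotientEquivalence

variable {C : Type u} [Category.{v} C] [Preadditive C] {D : Type u₁} [Category.{w} D]
  [Preadditive D]

/-- A full and essentially surjective additive functor with kernel the ideal `⟨K⟩` induces an
equivalence from the quotient by `⟨K⟩`. -/
lemma exists_quotient_equivalence (K : ObjectProperty C) (F : C ⥤ D) [F.Additive] [F.Full]
    [F.EssSurj] (h : ∀ ⦃X Y : C⦄ (f : X ⟶ Y), F.map f = 0 ↔ f ∈ idealHom K X Y) :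
    ∃ e : QuotientByIdeal K ≌ D, Nonempty (toQuotient K ⋙ e.functor ≅ F) := by
  have hQ : (toQuotient K).EssSurj := Quotient.essSurj_functor _
  have hQ' : (toQuotient K).Full := Quotient.full_functor _
  refine exists_equivalence_of_map_eq_iff (toQuotient K) F fun X Y f g => ?_
  have h₁ : (toQuotient K).map f = (toQuotient K).map g ↔ f - g ∈ idealHom K X Y :=
    Quotient.functor_map_eq_iff (idealRel K) f g
  rw [h₁, ← h, F.map_sub, sub_eq_zero]

/-- Being abelian for a given additive structure is invariant under equivalence. -/
lemma IsAbelianCategory.of_equivalence (h : IsAbelianCategory D) (e : C ≌ D) :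
    IsAbelianCategory C := by
  obtain ⟨a, rfl⟩ := h
  have : HasFiniteProducts C := ⟨fun n => Adjunction.hasLimitsOfShape_of_equivalence e.functor⟩
  exact ⟨abelianOfEquivalence e.functor, rfl⟩

end QuotientEquivalence

/-! ### Ladders between `n`-exact sequences -/

section Ladders

variable {C : Type u} [Category.{v} C] [Preadditive C] {n : ℕ} {S T : ComposableArrows C (n + 1)}

/-- Squares are filled from left to right: the next diagonal vanishes on the incoming differential
of `S`, because consecutive differentials of `T` compose to zero, so it factors by `desc`. -/
lemma IsNExact.exists_hom_of_first (hS : IsNExact S) (hT : IsNExact T)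
    (a₀ : S.obj' 0 ⟶ T.obj' 0) (a₁ : S.obj' 1 ⟶ T.obj' 1)
    (w : S.map' 0 1 ≫ a₁ = a₀ ≫ T.map' 0 1) :
    ∃ φ : S ⟶ T, ComposableArrows.app' φ 0 = a₀ ∧ ComposableArrows.app' φ 1 = a₁ := by
  have key : ∀ k : ℕ, k ≤ n → ∃ α : ∀ i : Fin (n + 1 + 1), S.obj i ⟶ T.obj i,
      α ⟨0, by lia⟩ = a₀ ∧ α ⟨1, by lia⟩ = a₁ ∧
      ∀ (i : ℕ) (hi : i ≤ n), i ≤ k →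
        S.map' i (i + 1) ≫ α ⟨i + 1, by lia⟩ = α ⟨i, by lia⟩ ≫ T.map' i (i + 1) := by
    intro k
    induction k with
    | zero =>
      intro _
      -- The zero components are placeholders; each inductive step overwrites the next one.
      refine ⟨Function.update (Function.update (fun _ => 0) ⟨0, by lia⟩ a₀) ⟨1, by lia⟩ a₁,
        ?_, ?_, ?_⟩
      · rw [Function.update_of_ne (by simp), Function.update_self]
      · rw [Function.update_self]
      · intro i hi hi0
        obtain rfl : i = 0 := by lia
        rw [Function.update_self, Function.update_of_ne (by simp), Function.update_self]
        exact w
    | succ k ih =>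
      intro hk
      obtain ⟨α, h₀, h₁, hα⟩ := ih (by lia)
      obtain ⟨h, hh⟩ := hS.desc k (by lia) _ (α ⟨k + 1, by lia⟩ ≫ T.map' (k + 1) (k + 2)) (by
        rw [← Category.assoc, hα k (by lia) le_rfl, Category.assoc, hT.zero k (by lia), comp_zero])
      refine ⟨Function.update α ⟨k + 2, by lia⟩ h, ?_, ?_, ?_⟩
      · rw [Function.update_of_ne (by simp), h₀]
      · rw [Function.update_of_ne (by simp), h₁]
      · intro i hi hik
        by_cases h' : i = k + 1
        · subst h'
          rw [Function.update_self, Function.update_of_ne (by simp)]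
          exact hh
        · rw [Function.update_of_ne (by simp; lia), Function.update_of_ne (by simp; lia)]
          exact hα i hi (by lia)
  obtain ⟨α, h₀, h₁, hα⟩ := key n le_rfl
  exact ⟨ComposableArrows.homMk α (fun i hi => hα i (by lia) (by lia)), h₀, h₁⟩

/-- Dual filling, from right to left, using `lift` in the target. In the induction, `j` is the
leftmost square already filled. -/
lemma IsNExact.exists_hom_of_last (hS : IsNExact S) (hT : IsNExact T)
    (a₀ : S.obj' n ⟶ T.obj' n) (a₁ : S.obj' (n + 1) ⟶ T.obj' (n + 1))
    (w : S.map' n (n + 1) ≫ a₁ = a₀ ≫ T.map' n (n + 1)) :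
    ∃ φ : S ⟶ T, ComposableArrows.app' φ n = a₀ ∧ ComposableArrows.app' φ (n + 1) = a₁ := by
  have key : ∀ k j : ℕ, j + k = n → ∃ α : ∀ i : Fin (n + 1 + 1), S.obj i ⟶ T.obj i,
      α ⟨n, by lia⟩ = a₀ ∧ α ⟨n + 1, by lia⟩ = a₁ ∧
      ∀ (i : ℕ) (hi : i ≤ n), j ≤ i →
        S.map' i (i + 1) ≫ α ⟨i + 1, by lia⟩ = α ⟨i, by lia⟩ ≫ T.map' i (i + 1) := by
    intro k
    induction k with
    | zero =>
      intro j hj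
      refine ⟨Function.update (Function.update (fun _ => 0) ⟨n, by lia⟩ a₀) ⟨n + 1, by lia⟩ a₁,
        ?_, ?_, ?_⟩
      · rw [Function.update_of_ne (by simp), Function.update_self]
      · rw [Function.update_self]
      · intro i hi hi0
        obtain rfl : i = n := by lia
        rw [Function.update_self, Function.update_of_ne (by simp), Function.update_self]
        exact w
    | succ k ih =>
      intro j hj
      obtain ⟨α, h₀, h₁, hα⟩ := ih (j + 1) (by lia)
      obtain ⟨h, hh⟩ := hT.lift j (by lia) _ (S.map' j (j + 1) ≫ α ⟨j + 1, by lia⟩) (by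
        rw [Category.assoc, ← hα (j + 1) (by lia) le_rfl, ← Category.assoc, hS.zero j (by lia),
          zero_comp])
      refine ⟨Function.update α ⟨j, by lia⟩ h, ?_, ?_, ?_⟩
      · rw [Function.update_of_ne (by simp; lia), h₀]
      · rw [Function.update_of_ne (by simp; lia), h₁]
      · intro i hi hik
        by_cases h' : i = j
        · subst h'
          rw [Function.update_self, Function.update_of_ne (by simp)]
          exact hh.symm
        · rw [Function.update_of_ne (by simp; lia), Function.update_of_ne (by simp; lia)]
          exact hα i hi (by lia)
  obtain ⟨α, h₀, h₁, hα⟩ := key n 0 (by lia)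
  exact ⟨ComposableArrows.homMk α (fun i hi => hα i (by lia) (by lia)), h₀, h₁⟩

/-- A morphism of `n`-exact sequences factors through the previous term at one place if and only if
it does so at every place. -/
lemma IsNExact.exists_homotopy_iff_succ (hS : IsNExact S) (hT : IsNExact T) (φ : S ⟶ T)
    (i : ℕ) (hi : i + 1 ≤ n) :
    (∃ h : S.obj' (i + 1) ⟶ T.obj' i,
      S.map' i (i + 1) ≫ h ≫ T.map' i (i + 1) = ComposableArrows.app' φ i ≫ T.map' i (i + 1)) ↔
    ∃ h : S.obj' (i + 2) ⟶ T.obj' (i + 1),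
      S.map' (i + 1) (i + 2) ≫ h ≫ T.map' (i + 1) (i + 2) =
        ComposableArrows.app' φ (i + 1) ≫ T.map' (i + 1) (i + 2) := by
  have nat₀ : S.map' i (i + 1) ≫ ComposableArrows.app' φ (i + 1) =
    ComposableArrows.app' φ i ≫ T.map' i (i + 1) := φ.naturality _
  have nat₁ : S.map' (i + 1) (i + 2) ≫ ComposableArrows.app' φ (i + 2) =
    ComposableArrows.app' φ (i + 1) ≫ T.map' (i + 1) (i + 2) := φ.naturality _
  constructor
  · rintro ⟨h, hh⟩
    -- The defect `φ - h ≫ d` vanishes on the incoming differential, so it extends to the next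
    -- homotopy component; composing with the next differential of `T` removes the term containing
    -- `h`.
    obtain ⟨h', hh'⟩ := hS.desc i (by lia) _
      (ComposableArrows.app' φ (i + 1) _ - h ≫ T.map' i (i + 1) (by lia) (by lia)) (by
        rw [Preadditive.comp_sub, hh, nat₀, sub_self])
    refine ⟨h', ?_⟩
    rw [← Category.assoc, hh', Preadditive.sub_comp, Category.assoc, hT.zero i (by lia), comp_zero,
      sub_zero]
  · rintro ⟨h, hh⟩
    obtain ⟨h', hh'⟩ := hT.lift i (by lia) _
      (ComposableArrows.app' φ (i + 1) _ - S.map' (i + 1) (i + 2) (by lia) (by lia) ≫ h) (by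
        rw [Preadditive.sub_comp, Category.assoc, hh, sub_self])
    refine ⟨h', ?_⟩
    rw [hh', Preadditive.comp_sub, ← Category.assoc, hS.zero i (by lia), zero_comp, sub_zero, nat₀]

/-- The intermediate condition is carried along all places. At the left end it simplifies by
cancelling the first map of `T`, a monomorphism, and at the right end by cancelling the last map of
`S`, an epimorphism. -/
lemma IsNExact.exists_homotopy_iff (hS : IsNExact S) (hT : IsNExact T) (φ : S ⟶ T) :
    (∃ h : S.obj' 1 ⟶ T.obj' 0, S.map' 0 1 ≫ h = ComposableArrows.app' φ 0) ↔
    ∃ h : S.obj' (n + 1) ⟶ T.obj' n, h ≫ T.map' n (n + 1) = ComposableArrows.app' φ (n + 1) := by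
  have key : ∀ i : ℕ, ∀ hi : i ≤ n,
      (∃ h : S.obj' 1 ⟶ T.obj' 0, S.map' 0 1 ≫ h = ComposableArrows.app' φ 0) ↔
      ∃ h : S.obj' (i + 1) ⟶ T.obj' i, S.map' i (i + 1) ≫ h ≫ T.map' i (i + 1) =
        ComposableArrows.app' φ i ≫ T.map' i (i + 1) := by
    intro i
    induction i with
    | zero =>
      intro _
      have := hT.mono
      refine exists_congr fun h => ?_
      rw [← cancel_mono (T.map' 0 1 _ _), Category.assoc]
    | succ i ih =>
      intro hi
      rw [ih (by lia), hS.exists_homotopy_iff_succ hT φ i hi]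
  rw [key n le_rfl]
  have := hS.epi
  refine exists_congr fun h => ?_
  have nat : S.map' n (n + 1) ≫ ComposableArrows.app' φ (n + 1) =
    ComposableArrows.app' φ n ≫ T.map' n (n + 1) := φ.naturality _
  rw [← nat, cancel_epi]

end Ladders

section FirstLast

variable {A : Type u} [Category.{v} A] [Abelian A] {M : ObjectProperty A}

lemma firstMono_full (hM : IsGenerating M) (n : ℕ) : (firstMono hM n).Full where
  map_surjective {S T} f := by
    obtain ⟨φ, h₀, h₁⟩ := S.property.exists_hom_of_first T.property f.hom.left f.hom.right
      (Arrow.w f.hom).symm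
    refine ⟨ObjectProperty.homMk φ, ?_⟩
    ext1
    exact Arrow.hom_ext _ _ h₀ h₁

lemma lastEpi_full (hM : IsCogenerating M) (n : ℕ) : (lastEpi hM n).Full where
  map_surjective {S T} f := by
    obtain ⟨φ, h₀, h₁⟩ := S.property.exists_hom_of_last T.property f.hom.left f.hom.right
      (Arrow.w f.hom).symm
    refine ⟨ObjectProperty.homMk φ, ?_⟩
    ext1
    exact Arrow.hom_ext _ _ h₀ h₁

end FirstLast

/-! ### Presentations of additive functors by generators and relations -/

section Presentations

variable {E : Type u} [Category.{v} E]

/-- The element `y` generates `F` and its relations are generated by `f`. -/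
structure IsPresentation (F : E ⥤ AddCommGrpCat.{w}) {Y X : E} (f : Y ⟶ X) (y : F.obj Y) :
    Prop where
  surj : ∀ ⦃Z : E⦄ (z : F.obj Z), ∃ g : Y ⟶ Z, F.map g y = z
  ker : ∀ ⦃Z : E⦄ (g : Y ⟶ Z), F.map g y = 0 ↔ ∃ h : X ⟶ Z, f ≫ h = g

variable {F G : E ⥤ AddCommGrpCat.{w}} {Y X Y' X' : E} {f : Y ⟶ X} {y : F.obj Y} {f' : Y' ⟶ X'}
  {y' : G.obj Y'}

lemma IsPresentation.map_relation (hF : IsPresentation F f y) : F.map f y = 0 :=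
  (hF.ker f).2 ⟨𝟙 X, Category.comp_id f⟩

lemma IsPresentation.hom_ext (hF : IsPresentation F f y) {α β : F ⟶ G}
    (h : α.app Y y = β.app Y y) : α = β := by
  ext Z z
  obtain ⟨g, rfl⟩ := hF.surj z
  rw [NatTrans.naturality_apply, NatTrans.naturality_apply, h]

lemma IsPresentation.of_iso (hF : IsPresentation F f y) (e : F ≅ G) :
    IsPresentation G f (e.hom.app Y y) where
  surj Z z := by
    obtain ⟨g, hg⟩ := hF.surj (e.inv.app Z z)
    refine ⟨g, ?_⟩
    rw [← NatTrans.naturality_apply, hg]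
    simp
  ker Z g := by
    rw [← hF.ker, ← NatTrans.naturality_apply]
    refine ⟨fun h => ?_, fun h => by rw [h, map_zero]⟩
    simpa using congrArg (e.inv.app Z) h

lemma comp_app_apply_eq_zero {F G H : E ⥤ AddCommGrpCat.{w}} {α : F ⟶ G} {β : G ⟶ H}
    (h : α ≫ β = 0) {Z : E} (z : F.obj Z) : β.app Z (α.app Z z) = 0 := by
  rw [← ConcreteCategory.comp_apply, ← NatTrans.comp_app, h]
  rfl

lemma exists_of_exact {F G H : E ⥤ AddCommGrpCat.{w}} {α : F ⟶ G} {β : G ⟶ H} {h : α ≫ β = 0}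
    (hex : (ShortComplex.mk α β h).Exact) {Z : E} (z : G.obj Z) (hz : β.app Z z = 0) :
    ∃ x : F.obj Z, α.app Z x = z := by
  have := hex.map ((evaluation E AddCommGrpCat.{w}).obj Z)
  rw [ShortComplex.ab_exact_iff] at this
  exact this z hz

lemma surjective_app_of_epi {F G : E ⥤ AddCommGrpCat.{w}} (α : F ⟶ G) [Epi α] (Z : E) :
    Function.Surjective (α.app Z) := by
  rw [← AddCommGrpCat.epi_iff_surjective]
  infer_instance

lemma injective_app_of_mono {F G : E ⥤ AddCommGrpCat.{w}} (α : F ⟶ G) [Mono α] (Z : E) :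
    Function.Injective (α.app Z) := by
  rw [← AddCommGrpCat.mono_iff_injective]
  infer_instance

/-- Evaluating `biprod.total` at `Z` recovers an element from its two components, without
identifying the biproduct of functors with a pointwise one. -/
lemma biprod_app_ext (F G : E ⥤ AddCommGrpCat.{w}) {Z : E} {x x' : (F ⊞ G).obj Z}
    (h₁ : (biprod.fst : F ⊞ G ⟶ F).app Z x = (biprod.fst : F ⊞ G ⟶ F).app Z x')
    (h₂ : (biprod.snd : F ⊞ G ⟶ G).app Z x = (biprod.snd : F ⊞ G ⟶ G).app Z x') : x = x' := by
  have key : ∀ t : (F ⊞ G).obj Z, t =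
      (biprod.inl : F ⟶ F ⊞ G).app Z ((biprod.fst : F ⊞ G ⟶ F).app Z t) +
      (biprod.inr : G ⟶ F ⊞ G).app Z ((biprod.snd : F ⊞ G ⟶ G).app Z t) := by
    intro t
    have := congrArg (fun α : F ⊞ G ⟶ F ⊞ G => α.app Z t) (biprod.total (X := F) (Y := G))
    exact this.symm
  rw [key x, key x', h₁, h₂]

lemma biprod_app_exists (F G : E ⥤ AddCommGrpCat.{w}) {Z : E} (x : F.obj Z) (x' : G.obj Z) :
    ∃ t : (F ⊞ G).obj Z, (biprod.fst : F ⊞ G ⟶ F).app Z t = x ∧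
      (biprod.snd : F ⊞ G ⟶ G).app Z t = x' := by
  have h₁ := congrArg (fun α => α.app Z x) (biprod.inl_fst (X := F) (Y := G))
  have h₂ := comp_app_apply_eq_zero (biprod.inr_fst (X := F) (Y := G)) x'
  have h₃ := comp_app_apply_eq_zero (biprod.inl_snd (X := F) (Y := G)) x
  have h₄ := congrArg (fun α => α.app Z x') (biprod.inr_snd (X := F) (Y := G))
  refine ⟨(biprod.inl : F ⟶ F ⊞ G).app Z x + (biprod.inr : G ⟶ F ⊞ G).app Z x', ?_, ?_⟩
  · rw [map_add, h₂, add_zero]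
    exact h₁
  · rw [map_add, h₃, zero_add]
    exact h₄

variable [Preadditive E]

lemma map_sub_apply (F : E ⥤ AddCommGrpCat.{w}) [F.Additive] {Y Z : E} (g g' : Y ⟶ Z)
    (y : F.obj Y) : F.map (g - g') y = F.map g y - F.map g' y := by
  rw [F.map_sub]
  rfl

lemma map_add_apply (F : E ⥤ AddCommGrpCat.{w}) [F.Additive] {Y Z : E} (g g' : Y ⟶ Z)
    (y : F.obj Y) : F.map (g + g') y = F.map g y + F.map g' y := by
  rw [F.map_add]
  rfl

lemma IsPresentation.map_eq_iff [F.Additive] (hF : IsPresentation F f y) {Z : E} (g g' : Y ⟶ Z) :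
    F.map g y = F.map g' y ↔ ∃ h : X ⟶ Z, f ≫ h = g - g' := by
  rw [← hF.ker, map_sub_apply, sub_eq_zero]

/-- Send `F.map g y` to `G.map g z`. This does not depend on `g`: two choices differ by a multiple
of `f`, and `f` kills `z`. -/
lemma IsPresentation.exists_hom [F.Additive] [G.Additive] (hF : IsPresentation F f y)
    (z : G.obj Y) (hz : G.map f z = 0) : ∃ α : F ⟶ G, α.app Y y = z := by
  choose s hs using hF.surj
  have key : ∀ ⦃Z : E⦄ (g : Y ⟶ Z), G.map (s (F.map g y)) z = G.map g z := by
    intro Z g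
    obtain ⟨h, hh⟩ := (hF.map_eq_iff _ _).1 (hs (F.map g y))
    rw [← sub_eq_zero, ← map_sub_apply, ← hh, Functor.map_comp, ConcreteCategory.comp_apply, hz,
      map_zero]
  refine ⟨{ app := fun Z => AddCommGrpCat.ofHom (AddMonoidHom.mk' (fun x => G.map (s x) z) ?_)
            naturality := ?_ }, ?_⟩
  · intro a b
    obtain ⟨g, rfl⟩ := hF.surj a
    obtain ⟨g', rfl⟩ := hF.surj b
    rw [← map_add_apply, key, key, key, map_add_apply]
  · intro Z W g
    ext x
    obtain ⟨g', rfl⟩ := hF.surj x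
    change G.map (s (F.map g (F.map g' y))) z = G.map g (G.map (s (F.map g' y)) z)
    rw [← ConcreteCategory.comp_apply, ← Functor.map_comp, key, key, Functor.map_comp,
      ConcreteCategory.comp_apply]
  · change G.map (s y) z = z
    have := key (𝟙 Y)
    simpa using this

/-- Functors with the same relations are isomorphic. -/
lemma IsPresentation.nonempty_iso [F.Additive] [G.Additive] {z : G.obj Y}
    (hF : IsPresentation F f y) (hG : IsPresentation G f z) : Nonempty (F ≅ G) := by
  obtain ⟨α, hα⟩ := hF.exists_hom z hG.map_relation
  obtain ⟨β, hβ⟩ := hG.exists_hom y hF.map_relation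
  exact ⟨⟨α, β, hF.hom_ext (by simp [hα, hβ]), hG.hom_ext (by simp [hα, hβ])⟩⟩

/-- The generator of `G` still generates the cokernel. To its relations `f'` one adds `r`, which
represents the image of the generator of `F`. -/
lemma IsPresentation.cokernel [HasBinaryBiproducts E] [F.Additive] [G.Additive]
    (hF : IsPresentation F f y) (hG : IsPresentation G f' y') (φ : F ⟶ G) {r : Y' ⟶ Y}
    (hr : G.map r y' = φ.app Y y) :
    IsPresentation (cokernel φ) (biprod.lift f' r) ((cokernel.π φ).app Y' y') where
  surj Z z := by
    obtain ⟨x, rfl⟩ := surjective_app_of_epi (cokernel.π φ) Z z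
    obtain ⟨g, rfl⟩ := hG.surj x
    exact ⟨g, by rw [NatTrans.naturality_apply]⟩
  ker Z g := by
    rw [← NatTrans.naturality_apply]
    constructor
    · intro h
      obtain ⟨x, hx⟩ := exists_of_exact (ShortComplex.exact_cokernel φ) _ h
      obtain ⟨t, rfl⟩ := hF.surj x
      rw [NatTrans.naturality_apply, ← hr, ← ConcreteCategory.comp_apply, ← Functor.map_comp,
        eq_comm, hG.map_eq_iff] at hx
      obtain ⟨h, hh⟩ := hx
      refine ⟨biprod.desc h t, ?_⟩
      rw [biprod.lift_desc, hh, sub_add_cancel]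
    · rintro ⟨h, rfl⟩
      have hh : biprod.lift f' r ≫ h = f' ≫ biprod.inl ≫ h + r ≫ biprod.inr ≫ h := by
        rw [← Category.assoc, ← Category.assoc, ← Preadditive.add_comp]
        congr 1
        ext <;> simp
      rw [hh, map_add_apply, (hG.ker _).2 ⟨_, rfl⟩, zero_add, Functor.map_comp,
        ConcreteCategory.comp_apply, hr, ← NatTrans.naturality_apply,
        comp_app_apply_eq_zero (cokernel.condition φ)]

/-- Existence of weak pushouts. -/
def HasWeakPushouts (E : Type u) [Category.{v} E] : Prop :=
  ∀ ⦃Z X Y : E⦄ (f : Z ⟶ X) (g : Z ⟶ Y), ∃ (W : E) (a : X ⟶ W) (b : Y ⟶ W), f ≫ a = g ≫ b ∧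
    ∀ ⦃T : E⦄ (s : X ⟶ T) (t : Y ⟶ T), f ≫ s = g ≫ t → ∃ u : W ⟶ T, a ≫ u = s ∧ b ≫ u = t

/-- The class of `s` lies in the kernel when `r ≫ s` factors through `f'`; the weak pushout of `r`
and `f'` gives a versal such `s`, namely `a`. The relations on its class are the `g` for which `a ≫
g` factors through `f`, and a second weak pushout gives a versal one. -/
lemma IsPresentation.exists_kernel (hE : HasWeakPushouts E) [F.Additive] [G.Additive]
    (hF : IsPresentation F f y) (hG : IsPresentation G f' y') (φ : F ⟶ G) :
    ∃ (W W' : E) (c : W ⟶ W') (x : (kernel φ).obj W), IsPresentation (kernel φ) c x := by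
  obtain ⟨r, hr⟩ := hG.surj (φ.app Y y)
  obtain ⟨W, a, b, hab, hW⟩ := hE r f'
  obtain ⟨W', c, d, hcd, hW'⟩ := hE a f
  obtain ⟨x, hx⟩ := exists_of_exact (ShortComplex.exact_kernel φ) (F.map a y) (by
    rw [NatTrans.naturality_apply, ← hr, ← ConcreteCategory.comp_apply, ← Functor.map_comp,
      hG.ker]
    exact ⟨b, hab.symm⟩)
  change (kernel.ι φ).app W x = F.map a y at hx
  refine ⟨W, W', c, x, fun Z z => ?_, fun Z g => ?_⟩
  · obtain ⟨s, hs⟩ := hF.surj ((kernel.ι φ).app Z z)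
    have h := comp_app_apply_eq_zero (kernel.condition φ) z
    rw [← hs, NatTrans.naturality_apply, ← hr, ← ConcreteCategory.comp_apply, ← Functor.map_comp,
      hG.ker] at h
    obtain ⟨t, ht⟩ := h
    obtain ⟨u, hu, -⟩ := hW s t ht.symm
    refine ⟨u, injective_app_of_mono (kernel.ι φ) Z ?_⟩
    rw [NatTrans.naturality_apply, hx, ← ConcreteCategory.comp_apply, ← Functor.map_comp, hu, hs]
  · rw [← (injective_iff_map_eq_zero' _).1 (injective_app_of_mono (kernel.ι φ) Z),
      NatTrans.naturality_apply, hx, ← ConcreteCategory.comp_apply, ← Functor.map_comp, hF.ker]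
    constructor
    · rintro ⟨v, hv⟩
      obtain ⟨u, hu, -⟩ := hW' g v hv.symm
      exact ⟨u, hu⟩
    · rintro ⟨u, rfl⟩
      exact ⟨d ≫ u, by rw [← Category.assoc, ← hcd, Category.assoc]⟩

instance biprod_additive [F.Additive] [G.Additive] : (F ⊞ G).Additive where
  map_add {Z W g g'} := by
    ext x
    refine biprod_app_ext F G ?_ ?_
    · rw [NatTrans.naturality_apply, map_add_apply]
      change _ = (biprod.fst : F ⊞ G ⟶ F).app W ((F ⊞ G).map g x + (F ⊞ G).map g' x)
      rw [map_add, NatTrans.naturality_apply, NatTrans.naturality_apply]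
    · rw [NatTrans.naturality_apply, map_add_apply]
      change _ = (biprod.snd : F ⊞ G ⟶ G).app W ((F ⊞ G).map g x + (F ⊞ G).map g' x)
      rw [map_add, NatTrans.naturality_apply, NatTrans.naturality_apply]

lemma IsPresentation.exists_biprod [HasBinaryBiproducts E] [F.Additive] [G.Additive]
    (hF : IsPresentation F f y) (hG : IsPresentation G f' y') :
    ∃ x : (F ⊞ G).obj (Y ⊞ Y'), IsPresentation (F ⊞ G) (biprod.map f f') x := by
  obtain ⟨x, h₁, h₂⟩ := biprod_app_exists F G (F.map biprod.inl y) (G.map biprod.inr y')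
  have h₁' : ∀ ⦃Z : E⦄ (g : Y ⊞ Y' ⟶ Z), (biprod.fst : F ⊞ G ⟶ F).app Z ((F ⊞ G).map g x) =
      F.map (biprod.inl ≫ g) y := by
    intro Z g
    rw [NatTrans.naturality_apply, h₁, Functor.map_comp, ConcreteCategory.comp_apply]
  have h₂' : ∀ ⦃Z : E⦄ (g : Y ⊞ Y' ⟶ Z), (biprod.snd : F ⊞ G ⟶ G).app Z ((F ⊞ G).map g x) =
      G.map (biprod.inr ≫ g) y' := by
    intro Z g
    rw [NatTrans.naturality_apply, h₂, Functor.map_comp, ConcreteCategory.comp_apply]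
  refine ⟨x, fun Z z => ?_, fun Z g => ?_⟩
  · obtain ⟨g, hg⟩ := hF.surj ((biprod.fst : F ⊞ G ⟶ F).app Z z)
    obtain ⟨g', hg'⟩ := hG.surj ((biprod.snd : F ⊞ G ⟶ G).app Z z)
    refine ⟨biprod.desc g g', biprod_app_ext F G ?_ ?_⟩
    · rw [h₁', biprod.inl_desc, hg]
    · rw [h₂', biprod.inr_desc, hg']
  · constructor
    · intro h
      have e₁ := h₁' g
      have e₂ := h₂' g
      rw [h, map_zero, eq_comm, hF.ker] at e₁
      rw [h, map_zero, eq_comm, hG.ker] at e₂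
      obtain ⟨s, hs⟩ := e₁
      obtain ⟨t, ht⟩ := e₂
      exact ⟨biprod.desc s t, by ext <;> simp [hs, ht]⟩
    · rintro ⟨h, rfl⟩
      refine biprod_app_ext F G ?_ ?_
      · rw [h₁', map_zero, hF.ker]
        exact ⟨biprod.inl ≫ h, by simp⟩
      · rw [h₂', map_zero, hG.ker]
        exact ⟨biprod.inr ≫ h, by simp⟩

end Presentations

/-! ### The functors `Θ` and its dual -/

section CokernelPresentations

variable {C : Type u} [Category.{v} C] [Preadditive C]

/-- The class of the identity in the cokernel of `C(-, f)`. -/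
def yonedaGenerator {X Y : C} (f : X ⟶ Y) :
    (cokernel (preadditiveYoneda.map f)).obj (op Y) :=
  (cokernel.π (preadditiveYoneda.map f)).app (op Y) (𝟙 Y : Y ⟶ Y)

lemma map_yonedaGenerator {X Y Z : C} (f : X ⟶ Y) (g : Z ⟶ Y) :
    (cokernel (preadditiveYoneda.map f)).map g.op (yonedaGenerator f) =
      (cokernel.π (preadditiveYoneda.map f)).app (op Z) (g : Z ⟶ Y) := by
  refine (NatTrans.naturality_apply _ _ _).symm.trans (congrArg _ ?_)
  exact Category.comp_id g

lemma isPresentation_yonedaGenerator {X Y : C} (f : X ⟶ Y) :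
    IsPresentation (cokernel (preadditiveYoneda.map f)) f.op (yonedaGenerator f) where
  surj Z z := by
    obtain ⟨g, rfl⟩ := surjective_app_of_epi (cokernel.π (preadditiveYoneda.map f)) Z z
    exact ⟨Quiver.Hom.op g, map_yonedaGenerator f _⟩
  ker Z g := by
    constructor
    · intro h
      obtain ⟨k, hk⟩ := exists_of_exact (ShortComplex.exact_cokernel (preadditiveYoneda.map f))
        (Z := Z) (g.unop : Z.unop ⟶ Y) ((map_yonedaGenerator f g.unop).symm.trans h)
      exact ⟨Quiver.Hom.op k, congrArg Quiver.Hom.op hk⟩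
    · rintro ⟨h, rfl⟩
      refine (map_yonedaGenerator f (h.unop ≫ f)).trans ?_
      exact comp_app_apply_eq_zero (cokernel.condition (preadditiveYoneda.map f)) (Z := Z)
        (h.unop : Z.unop ⟶ X)

/-- The class of the identity in the cokernel of `C(f, -)`. -/
def coyonedaGenerator {X Y : C} (f : X ⟶ Y) :
    (cokernel (preadditiveCoyoneda.map f.op)).obj X :=
  (cokernel.π (preadditiveCoyoneda.map f.op)).app X (𝟙 X : X ⟶ X)

lemma map_coyonedaGenerator {X Y Z : C} (f : X ⟶ Y) (g : X ⟶ Z) :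
    (cokernel (preadditiveCoyoneda.map f.op)).map g (coyonedaGenerator f) =
      (cokernel.π (preadditiveCoyoneda.map f.op)).app Z (g : X ⟶ Z) := by
  refine (NatTrans.naturality_apply _ _ _).symm.trans (congrArg _ ?_)
  exact Category.id_comp g

lemma isPresentation_coyonedaGenerator {X Y : C} (f : X ⟶ Y) :
    IsPresentation (cokernel (preadditiveCoyoneda.map f.op)) f (coyonedaGenerator f) where
  surj Z z := by
    obtain ⟨g, rfl⟩ := surjective_app_of_epi (cokernel.π (preadditiveCoyoneda.map f.op)) Z z
    exact ⟨g, map_coyonedaGenerator f _⟩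
  ker Z g := by
    constructor
    · intro h
      exact exists_of_exact (ShortComplex.exact_cokernel (preadditiveCoyoneda.map f.op))
        (Z := Z) (g : X ⟶ Z) ((map_coyonedaGenerator f g).symm.trans h)
    · rintro ⟨h, rfl⟩
      refine (map_coyonedaGenerator f (f ≫ h)).trans ?_
      exact comp_app_apply_eq_zero (cokernel.condition (preadditiveCoyoneda.map f.op)) (Z := Z)
        (h : Y ⟶ Z)

instance {X Y : C} (f : X ⟶ Y) : (cokernel (preadditiveYoneda.map f)).Additive :=
  additive_of_epi (cokernel.π (preadditiveYoneda.map f))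

instance {X Y : C} (f : X ⟶ Y) : (cokernel (preadditiveCoyoneda.map f.op)).Additive :=
  additive_of_epi (cokernel.π (preadditiveCoyoneda.map f.op))

lemma exists_isPresentation_of_exact_yoneda {F : Cᵒᵖ ⥤ AddCommGrpCat.{v}} {X Y : C}
    {a : preadditiveYoneda.obj X ⟶ preadditiveYoneda.obj Y} {b : preadditiveYoneda.obj Y ⟶ F}
    {w : a ≫ b = 0} (hex : (ShortComplex.mk a b w).Exact) [Epi b] :
    ∃ (f : X ⟶ Y) (y : F.obj (op Y)), IsPresentation F f.op y := by
  obtain ⟨f, rfl⟩ := preadditiveYoneda.map_surjective a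
  have e : cokernel (preadditiveYoneda.map f) ≅ F :=
    (cokernelIsCokernel _).coconePointUniqueUpToIso hex.gIsCokernel
  exact ⟨f, _, (isPresentation_yonedaGenerator f).of_iso e⟩

lemma exists_isPresentation_of_exact_coyoneda {F : C ⥤ AddCommGrpCat.{v}} {X Y : C}
    {a : preadditiveCoyoneda.obj (op X) ⟶ preadditiveCoyoneda.obj (op Y)}
    {b : preadditiveCoyoneda.obj (op Y) ⟶ F}
    {w : a ≫ b = 0} (hex : (ShortComplex.mk a b w).Exact) [Epi b] :
    ∃ (f : Y ⟶ X) (y : F.obj Y), IsPresentation F f y := by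
  obtain ⟨f, rfl⟩ := preadditiveCoyoneda.map_surjective a
  have e : cokernel (preadditiveCoyoneda.map f.unop.op) ≅ F :=
    (cokernelIsCokernel _).coconePointUniqueUpToIso hex.gIsCokernel
  exact ⟨f.unop, _, (isPresentation_coyonedaGenerator f.unop).of_iso e⟩

end CokernelPresentations

section Theta

variable {A : Type u} [Category.{v} A] [Abelian A] {M : ObjectProperty A}

/-- The underlying natural transformation of `Θ(φ)`. -/
abbrev thetaMap {f g : EpiCat M} (φ : f ⟶ g) :
    cokernel (preadditiveYoneda.map f.obj.hom) ⟶ cokernel (preadditiveYoneda.map g.obj.hom) :=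
  ((Theta M).map φ).hom

/-- Since the source is generated by one element, this formula determines `Θ(φ)`, and shows that it
depends only on the right component of `φ`. -/
lemma thetaMap_generator {f g : EpiCat M} (φ : f ⟶ g) :
    (thetaMap φ).app (op f.obj.right) (yonedaGenerator f.obj.hom) =
      (cokernel (preadditiveYoneda.map g.obj.hom)).map φ.hom.right.op
        (yonedaGenerator g.obj.hom) := by
  rw [map_yonedaGenerator]
  have h : cokernel.π (preadditiveYoneda.map f.obj.hom) ≫ thetaMap φ =
      preadditiveYoneda.map φ.hom.right ≫ cokernel.π (preadditiveYoneda.map g.obj.hom) :=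
    cokernel.π_desc _ _ _
  have h' := congrArg (fun α => α.app (op f.obj.right) (𝟙 f.obj.right : f.obj.right ⟶ f.obj.right))
    h
  exact h'.trans (congrArg ((cokernel.π (preadditiveYoneda.map g.obj.hom)).app (op f.obj.right))
    (Category.id_comp φ.hom.right))

/-- `Θ(φ)` vanishes when it kills the generator, that is, when the right component of `φ` is a
relation in the target cokernel. -/
lemma Theta_map_eq_zero_iff {f g : EpiCat M} (φ : f ⟶ g) :
    (Theta M).map φ = 0 ↔ ∃ h : f.obj.right ⟶ g.obj.left, h ≫ g.obj.hom = φ.hom.right := by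
  have key : (Theta M).map φ = 0 ↔ (cokernel (preadditiveYoneda.map g.obj.hom)).map φ.hom.right.op
        (yonedaGenerator g.obj.hom) = 0 := by
    rw [← thetaMap_generator]
    constructor
    · intro h
      rw [thetaMap, h]
      rfl
    · intro h
      ext1
      exact (isPresentation_yonedaGenerator f.obj.hom).hom_ext h
  rw [key, (isPresentation_yonedaGenerator g.obj.hom).ker]
  exact ⟨fun ⟨h, hh⟩ => ⟨h.unop, congrArg Quiver.Hom.unop hh⟩,
    fun ⟨h, hh⟩ => ⟨h.op, congrArg Quiver.Hom.op hh⟩⟩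

instance Theta_additive : (Theta M).Additive where
  map_add {f g φ ψ} := by
    ext1
    refine (isPresentation_yonedaGenerator f.obj.hom).hom_ext ?_
    refine (thetaMap_generator (φ + ψ)).trans ?_
    refine (map_add_apply _ φ.hom.right.op ψ.hom.right.op _).trans ?_
    rw [← thetaMap_generator, ← thetaMap_generator]
    rfl

instance Theta_full : (Theta M).Full where
  map_surjective {f g} ψ := by
    have hf := isPresentation_yonedaGenerator f.obj.hom
    have hg := isPresentation_yonedaGenerator g.obj.hom
    let α : cokernel (preadditiveYoneda.map f.obj.hom) ⟶
      cokernel (preadditiveYoneda.map g.obj.hom) := ψ.hom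
    -- The image of the generator supplies the right component; the image of the defining relation
    -- being zero then supplies the left one.
    obtain ⟨r, hr⟩ := hg.surj (α.app (op f.obj.right) (yonedaGenerator f.obj.hom))
    have h := congrArg (α.app (op f.obj.left)) hf.map_relation
    rw [NatTrans.naturality_apply, ← hr, map_zero, ← ConcreteCategory.comp_apply,
      ← Functor.map_comp, hg.ker] at h
    obtain ⟨l, hl⟩ := h
    refine ⟨ObjectProperty.homMk (Arrow.homMk l.unop r.unop (congrArg Quiver.Hom.unop hl)), ?_⟩
    ext1
    exact hf.hom_ext ((thetaMap_generator _).trans hr)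

lemma Theta_essSurj [EnoughProjectives A] (hM : ∀ P : A, Projective P → M P) :
    (Theta M).EssSurj where
  mem_essImage F := by
    obtain ⟨X, Y, a, b, w, hex, _⟩ := F.property.fp
    have := F.property.additive
    obtain ⟨f, y, hf⟩ := exists_isPresentation_of_exact_yoneda hex
    have hepi : Epi (M.ι.map f) := by
      -- Vanishing of `F` on a projective covering `Y` makes the covering map a relation, so it
      -- factors through `f`, and `f` is an epimorphism.
      let P : M.FullSubcategory := ⟨Projective.over Y.obj, hM _ inferInstance⟩
      let p : P ⟶ Y := M.homMk (Projective.π Y.obj)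
      have hP := F.property.vanish P (inferInstanceAs (Projective (Projective.over Y.obj)))
      have h0 : F.obj.map p.op y = 0 := by
        rw [hP.eq_of_tgt (F.obj.map p.op) 0]
        rfl
      obtain ⟨h, hh⟩ := (hf.ker _).1 h0
      have hp : M.ι.map h.unop ≫ M.ι.map f = Projective.π Y.obj := by
        rw [← Functor.map_comp]
        exact congrArg (fun t => M.ι.map (Quiver.Hom.unop t)) hh
      have : Epi (M.ι.map h.unop ≫ M.ι.map f) := by
        rw [hp]
        exact Projective.π_epi Y.obj
      exact epi_of_epi (M.ι.map h.unop) _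
    obtain ⟨e⟩ := (isPresentation_yonedaGenerator f).nonempty_iso hf
    exact ⟨⟨Arrow.mk f, hepi⟩, ⟨ObjectProperty.isoMk _ e⟩⟩

end Theta

section CoTheta

variable {A : Type u} [Category.{v} A] [Abelian A] {M : ObjectProperty A}

/-- The natural transformation underlying the image of `φ` under `coTheta`. -/
abbrev coThetaMap {f g : MonoCat M} (φ : f ⟶ g) :
    cokernel (preadditiveCoyoneda.map g.obj.hom.op) ⟶
      cokernel (preadditiveCoyoneda.map f.obj.hom.op) :=
  ((coTheta M).map φ).unop.hom

lemma coThetaMap_generator {f g : MonoCat M} (φ : f ⟶ g) :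
    (coThetaMap φ).app g.obj.left (coyonedaGenerator g.obj.hom) =
      (cokernel (preadditiveCoyoneda.map f.obj.hom.op)).map φ.hom.left
        (coyonedaGenerator f.obj.hom) := by
  rw [map_coyonedaGenerator]
  have h : cokernel.π (preadditiveCoyoneda.map g.obj.hom.op) ≫ coThetaMap φ =
      preadditiveCoyoneda.map φ.hom.left.op ≫
        cokernel.π (preadditiveCoyoneda.map f.obj.hom.op) :=
    cokernel.π_desc _ _ _
  have h' := congrArg (fun α => α.app g.obj.left (𝟙 g.obj.left : g.obj.left ⟶ g.obj.left)) h
  exact h'.trans (congrArg ((cokernel.π (preadditiveCoyoneda.map f.obj.hom.op)).app g.obj.left)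
    (Category.comp_id φ.hom.left))

lemma coTheta_map_eq_zero_iff {f g : MonoCat M} (φ : f ⟶ g) :
    (coTheta M).map φ = 0 ↔ ∃ h : f.obj.right ⟶ g.obj.left, f.obj.hom ≫ h = φ.hom.left := by
  rw [← (isPresentation_coyonedaGenerator f.obj.hom).ker, ← coThetaMap_generator]
  constructor
  · intro h
    rw [coThetaMap, h]
    rfl
  · intro h
    apply Quiver.Hom.unop_inj
    ext1
    exact (isPresentation_coyonedaGenerator g.obj.hom).hom_ext h

instance coTheta_additive : (coTheta M).Additive where
  map_add {f g φ ψ} := by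
    apply Quiver.Hom.unop_inj
    ext1
    refine (isPresentation_coyonedaGenerator g.obj.hom).hom_ext ?_
    refine (coThetaMap_generator (φ + ψ)).trans ?_
    refine (map_add_apply _ φ.hom.left ψ.hom.left _).trans ?_
    rw [← coThetaMap_generator, ← coThetaMap_generator]
    rfl

instance coTheta_full : (coTheta M).Full where
  map_surjective {f g} ψ := by
    have hf := isPresentation_coyonedaGenerator f.obj.hom
    have hg := isPresentation_coyonedaGenerator g.obj.hom
    let α : cokernel (preadditiveCoyoneda.map g.obj.hom.op) ⟶
      cokernel (preadditiveCoyoneda.map f.obj.hom.op) := ψ.unop.hom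
    obtain ⟨l, hl⟩ := hf.surj (α.app g.obj.left (coyonedaGenerator g.obj.hom))
    have h := congrArg (α.app g.obj.right) hg.map_relation
    rw [NatTrans.naturality_apply, ← hl, map_zero, ← ConcreteCategory.comp_apply,
      ← Functor.map_comp, hf.ker] at h
    obtain ⟨r, hr⟩ := h
    refine ⟨ObjectProperty.homMk (Arrow.homMk l r hr.symm), ?_⟩
    apply Quiver.Hom.unop_inj
    ext1
    exact hg.hom_ext ((coThetaMap_generator _).trans hl)

lemma coTheta_essSurj [EnoughInjectives A] (hM : ∀ I : A, Injective I → M I) :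
    (coTheta M).EssSurj where
  mem_essImage F := by
    obtain ⟨X, Y, a, b, w, hex, _⟩ := F.unop.property.fp
    have := F.unop.property.additive
    obtain ⟨f, y, hf⟩ := exists_isPresentation_of_exact_coyoneda hex
    have hmono : Mono (M.ι.map f) := by
      -- Dually, an embedding of `Y` into an injective is a relation, so it factors through `f`.
      let I : M.FullSubcategory := ⟨Injective.under Y.obj, hM _ inferInstance⟩
      let j : Y ⟶ I := M.homMk (Injective.ι Y.obj)
      have hI := F.unop.property.vanish I (inferInstanceAs (Injective (Injective.under Y.obj)))
      have h0 : F.unop.obj.map j y = 0 := by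
        rw [hI.eq_of_tgt (F.unop.obj.map j) 0]
        rfl
      obtain ⟨h, hh⟩ := (hf.ker _).1 h0
      have hp : M.ι.map f ≫ M.ι.map h = Injective.ι Y.obj := by
        rw [← Functor.map_comp]
        exact congrArg M.ι.map hh
      have : Mono (M.ι.map f ≫ M.ι.map h) := by
        rw [hp]
        exact Injective.ι_mono Y.obj
      exact mono_of_mono _ (M.ι.map h)
    obtain ⟨e⟩ := (isPresentation_coyonedaGenerator f).nonempty_iso hf
    let e' : (⟨_, isStableLeft_cokernel M ⟨Arrow.mk f, hmono⟩⟩ : StableLeftMod M) ≅ F.unop :=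
      ObjectProperty.isoMk _ e
    exact ⟨⟨Arrow.mk f, hmono⟩, ⟨e'.symm.op⟩⟩

end CoTheta

/-! ### The kernels of `Θ` and its dual -/

section Kernels

variable {A : Type u} [Category.{v} A] [Abelian A] {M : ObjectProperty A}

/-- The identity of `N` as an object of `F(M)`. -/
def EpiCat.ofId (N : M.FullSubcategory) : EpiCat M := ⟨Arrow.mk (𝟙 N), by
  change Epi (M.ι.map (𝟙 N))
  infer_instance⟩

/-- The morphism from `N` to a zero object as an object of `F(M)`. -/
def EpiCat.toZero (N : M.FullSubcategory) {O : M.FullSubcategory} (hO : IsZero O.obj) :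
    EpiCat M := ⟨Arrow.mk (0 : N ⟶ O), ⟨fun _ _ _ => hO.eq_of_src _ _⟩⟩

/-- The identity of `N` as an object of `S(M)`. -/
def MonoCat.ofId (N : M.FullSubcategory) : MonoCat M := ⟨Arrow.mk (𝟙 N), by
  change Mono (M.ι.map (𝟙 N))
  infer_instance⟩

/-- The morphism from a zero object to `N` as an object of `S(M)`. -/
def MonoCat.fromZero (N : M.FullSubcategory) {O : M.FullSubcategory} (hO : IsZero O.obj) :
    MonoCat M := ⟨Arrow.mk (0 : O ⟶ N), ⟨fun _ _ _ => hO.eq_of_tgt _ _⟩⟩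

lemma isZero_of_isZero_obj {O : M.FullSubcategory} (hO : IsZero O.obj) : IsZero O := by
  rw [IsZero.iff_id_eq_zero]
  ext1
  exact hO.eq_of_src _ _

/-- If `φ.right = h ≫ g`, then `(f ≫ h, φ.right)` factors through the identity of the target of `f`.
The remainder `(φ.left - f ≫ h, 0)` factors through the map from the source of `f` to zero. -/
lemma Theta_map_eq_zero_iff_mem_idealHom {O : M.FullSubcategory} (hO : IsZero O.obj)
    {f g : EpiCat M} (φ : f ⟶ g) : (Theta M).map φ = 0 ↔ φ ∈ idealHom (genV' M) f g := by
  constructor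
  · rw [Theta_map_eq_zero_iff]
    rintro ⟨h, hh⟩
    have w : φ.hom.left ≫ g.obj.hom = f.obj.hom ≫ φ.hom.right := Arrow.w φ.hom
    have e : φ = (ObjectProperty.homMk (Arrow.homMk f.obj.hom (𝟙 _)) :
          f ⟶ EpiCat.ofId f.obj.right) ≫
        ObjectProperty.homMk (Arrow.homMk h φ.hom.right (hh.trans (Category.id_comp _).symm)) +
        (ObjectProperty.homMk (Arrow.homMk (𝟙 _) 0 (comp_zero.trans comp_zero.symm)) :
          f ⟶ EpiCat.toZero f.obj.left hO) ≫
        ObjectProperty.homMk (Arrow.homMk (φ.hom.left - f.obj.hom ≫ h) 0 (by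
          refine Eq.trans ?_ comp_zero.symm
          change (φ.hom.left - f.obj.hom ≫ h) ≫ g.obj.hom = 0
          rw [Preadditive.sub_comp, w, Category.assoc, hh, sub_self])) := by
      ext1
      apply Arrow.hom_ext
      · change φ.hom.left = f.obj.hom ≫ h + 𝟙 f.obj.left ≫ (φ.hom.left - f.obj.hom ≫ h)
        rw [Category.id_comp, add_sub_cancel]
      · change φ.hom.right = 𝟙 f.obj.right ≫ φ.hom.right + 0 ≫ 0
        rw [Category.id_comp, comp_zero, add_zero]
    rw [e]
    exact add_mem
      (AddSubgroup.subset_closure ⟨_, _, _, Or.inl (inferInstanceAs (IsIso (𝟙 _))), rfl⟩)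
      (AddSubgroup.subset_closure ⟨_, _, _, Or.inr (isZero_of_isZero_obj hO), rfl⟩)
  · intro hφ
    refine AddSubgroup.closure_induction (p := fun φ _ => (Theta M).map φ = 0) ?_ ?_ ?_ ?_ hφ
    · rintro _ ⟨Z, a, b, hZ, rfl⟩
      rw [Theta_map_eq_zero_iff]
      obtain hZ | hZ := hZ
      · refine ⟨a.hom.right ≫ inv Z.obj.hom ≫ b.hom.left, ?_⟩
        have w : b.hom.left ≫ g.obj.hom = Z.obj.hom ≫ b.hom.right := Arrow.w b.hom
        rw [Category.assoc, Category.assoc, w, IsIso.inv_hom_id_assoc]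
        rfl
      · refine ⟨0, ?_⟩
        rw [zero_comp]
        change 0 = a.hom.right ≫ b.hom.right
        rw [hZ.eq_of_tgt a.hom.right 0, zero_comp]
    · exact (Theta M).map_zero _ _
    · intro _ _ _ _ h₁ h₂
      rw [(Theta M).map_add, h₁, h₂, add_zero]
    · intro _ _ h
      rw [(Theta M).map_neg, h, neg_zero]

/-- Here `φ.left = f ≫ h`: the part `(φ.left, h ≫ g)` passes through the identity of the source of
`g`, and `(0, φ.right - h ≫ g)` through the map from zero to the target of `g`. -/
lemma coTheta_map_eq_zero_iff_mem_idealHom {O : M.FullSubcategory} (hO : IsZero O.obj)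
    {f g : MonoCat M} (φ : f ⟶ g) : (coTheta M).map φ = 0 ↔ φ ∈ idealHom (genV M) f g := by
  constructor
  · rw [coTheta_map_eq_zero_iff]
    rintro ⟨h, hh⟩
    have w : φ.hom.left ≫ g.obj.hom = f.obj.hom ≫ φ.hom.right := Arrow.w φ.hom
    have e : φ = (ObjectProperty.homMk (Arrow.homMk φ.hom.left h
            ((Category.comp_id _).trans hh.symm)) : f ⟶ MonoCat.ofId g.obj.left) ≫
        (ObjectProperty.homMk (Arrow.homMk (𝟙 _) g.obj.hom) : MonoCat.ofId g.obj.left ⟶ g) +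
        (ObjectProperty.homMk (Arrow.homMk 0 (φ.hom.right - h ≫ g.obj.hom) (by
          refine zero_comp.trans ?_
          change 0 = f.obj.hom ≫ (φ.hom.right - h ≫ g.obj.hom)
          rw [Preadditive.comp_sub, ← w, ← Category.assoc, hh, sub_self])) :
          f ⟶ MonoCat.fromZero g.obj.right hO) ≫
        (ObjectProperty.homMk (Arrow.homMk 0 (𝟙 _) (zero_comp.trans zero_comp.symm)) :
          MonoCat.fromZero g.obj.right hO ⟶ g) := by
      ext1
      apply Arrow.hom_ext
      · change φ.hom.left = φ.hom.left ≫ 𝟙 g.obj.left + 0 ≫ 0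
        rw [Category.comp_id, comp_zero, add_zero]
      · change φ.hom.right = h ≫ g.obj.hom + (φ.hom.right - h ≫ g.obj.hom) ≫ 𝟙 g.obj.right
        rw [Category.comp_id, add_sub_cancel]
    rw [e]
    exact add_mem
      (AddSubgroup.subset_closure ⟨_, _, _, Or.inl (inferInstanceAs (IsIso (𝟙 _))), rfl⟩)
      (AddSubgroup.subset_closure ⟨_, _, _, Or.inr (isZero_of_isZero_obj hO), rfl⟩)
  · intro hφ
    refine AddSubgroup.closure_induction (p := fun φ _ => (coTheta M).map φ = 0) ?_ ?_ ?_ ?_ hφ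
    · rintro _ ⟨Z, a, b, hZ, rfl⟩
      rw [coTheta_map_eq_zero_iff]
      obtain hZ | hZ := hZ
      · refine ⟨a.hom.right ≫ inv Z.obj.hom ≫ b.hom.left, ?_⟩
        have w : a.hom.left ≫ Z.obj.hom = f.obj.hom ≫ a.hom.right := Arrow.w a.hom
        rw [← Category.assoc, ← w, Category.assoc, IsIso.hom_inv_id_assoc]
        rfl
      · refine ⟨0, ?_⟩
        rw [comp_zero]
        change 0 = a.hom.left ≫ b.hom.left
        rw [hZ.eq_of_tgt a.hom.left 0, zero_comp]
    · exact (coTheta M).map_zero _ _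
    · intro _ _ _ _ h₁ h₂
      rw [(coTheta M).map_add, h₁, h₂, add_zero]
    · intro _ _ h
      rw [(coTheta M).map_neg, h, neg_zero]

lemma Theta_isObjective [HasBinaryBiproducts M.FullSubcategory] : IsObjective (Theta M) := by
  intro f g φ hφ
  obtain ⟨h, hh⟩ := (Theta_map_eq_zero_iff φ).1 hφ
  have w : φ.hom.left ≫ g.obj.hom = f.obj.hom ≫ φ.hom.right := Arrow.w φ.hom
  -- This projection is the direct sum of an identity object and a map to zero, so both summands of
  -- the morphism pass through a single object. It is split epi, hence killed by `Θ`.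
  let p : f.obj.right ⊞ f.obj.left ⟶ f.obj.right := biprod.fst
  let K : EpiCat M := ⟨Arrow.mk p, inferInstanceAs (Epi (M.ι.map p))⟩
  let a : f ⟶ K := ObjectProperty.homMk (Arrow.homMk (biprod.lift f.obj.hom (𝟙 _)) (𝟙 _)
    ((biprod.lift_fst _ _).trans (Category.comp_id _).symm))
  let b : K ⟶ g := ObjectProperty.homMk
    (Arrow.homMk (biprod.desc h (φ.hom.left - f.obj.hom ≫ h)) φ.hom.right (by
      change biprod.desc h (φ.hom.left - f.obj.hom ≫ h) ≫ g.obj.hom = biprod.fst ≫ φ.hom.right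
      apply biprod.hom_ext'
      · rw [biprod.inl_desc_assoc, biprod.inl_fst_assoc, hh]
      · rw [biprod.inr_desc_assoc, biprod.inr_fst_assoc, zero_comp, Preadditive.sub_comp, w,
          Category.assoc, hh, sub_self]))
  refine ⟨K, a, b, ?_, ?_⟩
  · refine (IsZero.iff_id_eq_zero _).2 (((Theta M).map_id K).symm.trans ?_)
    rw [Theta_map_eq_zero_iff]
    exact ⟨(biprod.inl : f.obj.right ⟶ f.obj.right ⊞ f.obj.left), biprod.inl_fst⟩
  · ext1
    apply Arrow.hom_ext
    · change biprod.lift f.obj.hom (𝟙 _) ≫ biprod.desc h (φ.hom.left - f.obj.hom ≫ h) = φ.hom.left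
      rw [biprod.lift_desc, Category.id_comp, add_sub_cancel]
    · exact Category.id_comp _

end Kernels

/-! ### `mod-M̲` is abelian -/

section StableAbelian

variable {A : Type u} [Category.{v} A] [Abelian A] {M : ObjectProperty A}
  {F G : M.FullSubcategoryᵒᵖ ⥤ AddCommGrpCat.{v}}

lemma IsStableRight.exists_isPresentation (hF : IsStableRight M F) :
    ∃ (Y X : M.FullSubcategoryᵒᵖ) (f : Y ⟶ X) (y : F.obj Y), IsPresentation F f y := by
  obtain ⟨X, Y, a, b, w, hex, _⟩ := hF.fp
  obtain ⟨f, y, h⟩ := exists_isPresentation_of_exact_yoneda hex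
  exact ⟨_, _, f.op, y, h⟩

lemma IsPresentation.isStableRight [hF : F.Additive] {Y X : M.FullSubcategoryᵒᵖ} {f : Y ⟶ X}
    {y : F.obj Y} (h : IsPresentation F f y)
    (hv : ∀ P : M.FullSubcategory, Projective P.obj → ∀ z : F.obj (op P), z = 0) :
    IsStableRight M F where
  additive := hF
  fp := by
    obtain ⟨e⟩ := (isPresentation_yonedaGenerator f.unop).nonempty_iso h
    refine ⟨X.unop, Y.unop, preadditiveYoneda.map f.unop, cokernel.π _ ≫ e.hom,
      by rw [cokernel.condition_assoc, zero_comp], ?_, inferInstance⟩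
    exact ShortComplex.exact_of_g_is_cokernel _
      (CokernelCofork.IsColimit.ofπ' _ _ fun k hk =>
        ⟨e.inv ≫ cokernel.desc _ k hk, by simp⟩)
  vanish P hP := by
    rw [IsZero.iff_id_eq_zero]
    ext z
    exact hv P hP z

lemma IsStableRight.eq_zero (hF : IsStableRight M F) (P : M.FullSubcategory)
    (hP : Projective P.obj) (z : F.obj (op P)) : z = 0 :=
  congrArg (fun α : F.obj (op P) ⟶ F.obj (op P) => α z)
    ((IsZero.iff_id_eq_zero _).1 (hF.vanish P hP))

lemma IsStableRight.of_iso (hF : IsStableRight M F) (e : F ≅ G) : IsStableRight M G := by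
  obtain ⟨Y, X, f, y, h⟩ := hF.exists_isPresentation
  have := hF.additive
  have := additive_of_epi e.hom
  refine (h.of_iso e).isStableRight fun P hP z => ?_
  obtain ⟨x, rfl⟩ := surjective_app_of_epi e.hom _ z
  rw [hF.eq_zero P hP x, map_zero]

lemma IsStableRight.cokernel [HasBinaryBiproducts M.FullSubcategoryᵒᵖ] (hF : IsStableRight M F)
    (hG : IsStableRight M G) (φ : F ⟶ G) : IsStableRight M (cokernel φ) := by
  obtain ⟨Y, X, f, y, h⟩ := hF.exists_isPresentation
  obtain ⟨Y', X', f', y', h'⟩ := hG.exists_isPresentation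
  have := hF.additive
  have := hG.additive
  have := additive_of_epi (cokernel.π φ)
  obtain ⟨r, hr⟩ := h'.surj (φ.app Y y)
  refine (h.cokernel h' φ hr).isStableRight fun P hP z => ?_
  obtain ⟨x, rfl⟩ := surjective_app_of_epi (cokernel.π φ) _ z
  rw [hG.eq_zero P hP x, map_zero]

lemma additive_of_mono {F G : M.FullSubcategoryᵒᵖ ⥤ AddCommGrpCat.{v}} [G.Additive] (i : F ⟶ G)
    [Mono i] : F.Additive where
  map_add {X Y f g} := by
    rw [← cancel_mono (i.app Y), Preadditive.add_comp, i.naturality, i.naturality,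
      i.naturality, G.map_add, Preadditive.comp_add]

lemma IsStableRight.kernel (hE : HasWeakPushouts M.FullSubcategoryᵒᵖ) (hF : IsStableRight M F)
    (hG : IsStableRight M G) (φ : F ⟶ G) : IsStableRight M (kernel φ) := by
  obtain ⟨Y, X, f, y, h⟩ := hF.exists_isPresentation
  obtain ⟨Y', X', f', y', h'⟩ := hG.exists_isPresentation
  have := hF.additive
  have := hG.additive
  have := additive_of_mono (kernel.ι φ)
  obtain ⟨_, _, _, _, hk⟩ := h.exists_kernel hE h' φ
  refine hk.isStableRight fun P hP z => injective_app_of_mono (kernel.ι φ) _ ?_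
  rw [map_zero]
  exact hF.eq_zero P hP _

lemma IsStableRight.biprod [HasBinaryBiproducts M.FullSubcategoryᵒᵖ] (hF : IsStableRight M F)
    (hG : IsStableRight M G) : IsStableRight M (F ⊞ G) := by
  obtain ⟨Y, X, f, y, h⟩ := hF.exists_isPresentation
  obtain ⟨Y', X', f', y', h'⟩ := hG.exists_isPresentation
  have := hF.additive
  have := hG.additive
  obtain ⟨x, hx⟩ := h.exists_biprod h'
  refine hx.isStableRight fun P hP z => biprod_app_ext F G ?_ ?_
  · rw [hF.eq_zero P hP ((biprod.fst : F ⊞ G ⟶ F).app _ z), map_zero]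
  · rw [hG.eq_zero P hP ((biprod.snd : F ⊞ G ⟶ G).app _ z), map_zero]

lemma isStableRight_of_isZero (Y : M.FullSubcategory) (hF : IsZero F) : IsStableRight M F := by
  have hz : ∀ Z, Subsingleton (F.obj Z) := fun Z =>
    AddCommGrpCat.subsingleton_of_isZero (hF.obj Z)
  have : F.Additive := { map_add := fun {_ Z _ _} => (hF.obj Z).eq_of_tgt _ _ }
  have h : IsPresentation F (𝟙 (op Y)) 0 :=
    { surj := fun Z z => ⟨0, Subsingleton.elim _ _⟩
      ker := fun Z g => ⟨fun _ => ⟨g, Category.id_comp g⟩, fun _ => Subsingleton.elim _ _⟩ }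
  exact h.isStableRight fun P _ z => Subsingleton.elim _ _

/-- A full subcategory of the abelian functor category that is closed under kernels, cokernels and
finite products is abelian for the inherited additive structure. The object `Y` serves to present
the zero functor. -/
lemma isAbelianCategory_stableRightMod [HasBinaryBiproducts M.FullSubcategory]
    (hE : HasWeakPushouts M.FullSubcategoryᵒᵖ) (Y : M.FullSubcategory) :
    IsAbelianCategory (StableRightMod M) := by
  have : ObjectProperty.IsClosedUnderIsomorphisms (IsStableRight M) := ⟨fun e h => h.of_iso e⟩
  have : ObjectProperty.ContainsZero (IsStableRight M) := ⟨⟨_, isZero_zero _, isStableRight_of_isZero Y (isZero_zero _)⟩⟩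
  have : ObjectProperty.IsClosedUnderKernels (IsStableRight M) := ⟨by
    rintro _ ⟨f, k, hk, hf⟩
    exact (hf.1.kernel hE hf.2 f).of_iso ((kernelIsKernel f).conePointUniqueUpToIso hk)⟩
  have : ObjectProperty.IsClosedUnderCokernels (IsStableRight M) := ⟨by
    rintro _ ⟨f, k, hk, hf⟩
    exact (hf.1.cokernel hf.2 f).of_iso ((cokernelIsCokernel f).coconePointUniqueUpToIso hk)⟩
  have : ObjectProperty.IsClosedUnderBinaryProducts (IsStableRight M) := ⟨by
    rintro X ⟨p⟩
    let e : p.diag ≅ pair (p.diag.obj ⟨WalkingPair.left⟩) (p.diag.obj ⟨WalkingPair.right⟩) :=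
      diagramIsoPair p.diag
    refine IsStableRight.of_iso ((p.prop_diag_obj ⟨WalkingPair.left⟩).biprod
      (p.prop_diag_obj ⟨WalkingPair.right⟩)) ?_
    exact (BinaryBiproduct.isLimit _ _).conePointsIsoOfNatIso p.isLimit e.symm⟩
  have : ObjectProperty.IsClosedUnderFiniteProducts (IsStableRight M) := .mk'
  exact ⟨inferInstance, rfl⟩

/-- Pullbacks and right approximations give weak pullbacks. -/
lemma hasWeakPushouts_op (hM : IsContravariantlyFinite M) :
    HasWeakPushouts M.FullSubcategoryᵒᵖ := by
  intro Z X Y f g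
  obtain ⟨W, p, hW, hp⟩ := hM (pullback (M.ι.map f.unop) (M.ι.map g.unop))
  refine ⟨op ⟨W, hW⟩, Quiver.Hom.op (M.homMk (p ≫ pullback.fst _ _)),
    Quiver.Hom.op (M.homMk (p ≫ pullback.snd _ _)), ?_, ?_⟩
  · apply Quiver.Hom.unop_inj
    apply M.ι.map_injective
    change (p ≫ pullback.fst _ _) ≫ M.ι.map f.unop = (p ≫ pullback.snd _ _) ≫ M.ι.map g.unop
    rw [Category.assoc, Category.assoc, pullback.condition]
  · intro T s t hst
    have h : M.ι.map s.unop ≫ M.ι.map f.unop = M.ι.map t.unop ≫ M.ι.map g.unop := by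
      rw [← Functor.map_comp, ← Functor.map_comp]
      exact congrArg (fun k => M.ι.map (Quiver.Hom.unop k)) hst
    obtain ⟨u, hu⟩ := hp T.unop.obj (pullback.lift _ _ h) T.unop.property
    refine ⟨Quiver.Hom.op (M.homMk u), ?_, ?_⟩
    · apply Quiver.Hom.unop_inj
      apply M.ι.map_injective
      change u ≫ p ≫ pullback.fst _ _ = M.ι.map s.unop
      rw [← Category.assoc, hu, pullback.lift_fst]
    · apply Quiver.Hom.unop_inj
      apply M.ι.map_injective
      change u ≫ p ≫ pullback.snd _ _ = M.ι.map t.unop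
      rw [← Category.assoc, hu, pullback.lift_snd]

end StableAbelian

/-! ### Construction of `n`-exact sequences -/

section Coresolution

variable {A : Type u} [Category.{v} A] [Abelian A]

/-- The differentials of a sequence of morphisms. -/
abbrev seqD (F : ℕ ⥤ A) (k : ℕ) : F.obj k ⟶ F.obj (k + 1) := F.map (homOfLE (Nat.le_add_right k 1))

/-- The first `n + 2` terms of the sequence `F` form an `n`-exact sequence with respect to test
objects in `M`. -/
structure IsNExactFor (M : ObjectProperty A) (n : ℕ) (F : ℕ ⥤ A) : Prop where
  prop : ∀ k, M (F.obj k)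
  zero : ∀ k, seqD F k ≫ seqD F (k + 1) = 0
  mono : Mono (seqD F 0)
  lift : ∀ k, k + 1 ≤ n → ∀ T : A, M T → ∀ g : T ⟶ F.obj (k + 1), g ≫ seqD F (k + 1) = 0 →
    ∃ h : T ⟶ F.obj k, h ≫ seqD F k = g
  epi : Epi (seqD F n)
  desc : ∀ k, ∀ T : A, M T → ∀ g : F.obj (k + 1) ⟶ T, seqD F k ≫ g = 0 →
    ∃ h : F.obj (k + 2) ⟶ T, seqD F (k + 1) ≫ h = g

/-- The formal properties of the vanishing of `Extⁱ` used in the construction of `n`-cokernels of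
monomorphisms. -/
structure IsVanishing (M : ObjectProperty A) (n : ℕ) (V : ℕ → A → A → Prop) : Prop where
  vanish : ∀ ⦃X Y : A⦄, M X → M Y → ∀ i, 0 < i → i < n → V i X Y
  mem : ∀ X : A, (∀ Y : A, M Y → ∀ i, 0 < i → i < n → V i X Y) → M X
  quotient : ∀ ⦃S : ShortComplex A⦄, S.ShortExact → ∀ i N, V i S.X₁ N → V (i + 1) S.X₂ N →
    V (i + 1) S.X₃ N
  quotient_one : ∀ ⦃S : ShortComplex A⦄, S.ShortExact → ∀ N,
    (∀ g : S.X₁ ⟶ N, ∃ h : S.X₂ ⟶ N, S.f ≫ h = g) → V 1 S.X₂ N → V 1 S.X₃ N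
  to_quotient : ∀ ⦃S : ShortComplex A⦄, S.ShortExact → ∀ i T, V i T S.X₂ → V (i + 1) T S.X₁ →
    V i T S.X₃
  lift : ∀ ⦃S : ShortComplex A⦄, S.ShortExact → ∀ T, V 1 T S.X₁ → ∀ g : T ⟶ S.X₃,
    ∃ h : T ⟶ S.X₂, h ≫ S.g = g

/-- Iterated approximation of cokernels, starting with `f`. -/
def coresolution {Y : A → A} (i : ∀ C, C ⟶ Y C) (f : Arrow A) : ℕ → Arrow A
  | 0 => f
  | k + 1 => Arrow.mk (i (cokernel (coresolution i f k).hom))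

/-- The terms of the sequence built from `coresolution`. -/
def coresolutionObj {Y : A → A} (i : ∀ C, C ⟶ Y C) (f : Arrow A) : ℕ → A
  | 0 => f.left
  | k + 1 => (coresolution i f k).right

/-- The differentials of the sequence built from `coresolution`. -/
def coresolutionD {Y : A → A} (i : ∀ C, C ⟶ Y C) (f : Arrow A) :
    ∀ k, coresolutionObj i f k ⟶ coresolutionObj i f (k + 1)
  | 0 => f.hom
  | k + 1 => cokernel.π (coresolution i f k).hom ≫ (coresolution i f (k + 1)).hom

/-- The short exact sequence defined by a monomorphism. -/
abbrev cokernelSequence (f : Arrow A) : ShortComplex A :=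
  ShortComplex.mk f.hom (cokernel.π f.hom) (cokernel.condition f.hom)

lemma cokernelSequence_shortExact (f : Arrow A) [Mono f.hom] : (cokernelSequence f).ShortExact where
  exact := ShortComplex.exact_cokernel f.hom
  mono_f := inferInstance
  epi_g := inferInstance

variable {M : ObjectProperty A}

/-- With `C₀` the source of `f`, let `C₁` be its cokernel, embed `C₁` by a left approximation, let
`C₂` be the cokernel, and so on. Approximations give exactness under maps into `M`, vanishing of
`Ext¹(T, C_k)` gives it under maps from `M`, and `C_n` lies in `M`, so the sequence ends there. -/
lemma exists_isNExactFor {n : ℕ} (hn : 1 ≤ n) {V : ℕ → A → A → Prop} (hV : IsVanishing M n V)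
    (hM : IsCovariantlyFinite M) (hM' : IsCogenerating M) (f : Arrow A) [Mono f.hom]
    (h₀ : M f.left) (h₁ : M f.right) :
    ∃ (F : ℕ ⥤ A) (_ : IsNExactFor M n F) (e₀ : F.obj 0 ≅ f.left) (e₁ : F.obj 1 ≅ f.right),
      e₀.hom ≫ f.hom = seqD F 0 ≫ e₁.hom := by
  -- Left approximations are monomorphisms because `M` is cogenerating. An object already in `M` is
  -- approximated by its identity, which makes the sequence stop at stage `n`.
  have approx : ∀ C : A, ∃ (Y : A) (i : C ⟶ Y), M Y ∧ Mono i ∧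
      (∀ N, M N → ∀ g : C ⟶ N, ∃ h : Y ⟶ N, i ≫ h = g) ∧ (M C → IsIso i) := by
    intro C
    by_cases hC : M C
    · exact ⟨C, 𝟙 C, hC, inferInstance, fun N _ g => ⟨g, Category.id_comp g⟩,
        fun _ => inferInstance⟩
    · obtain ⟨Y, i, hY, hi⟩ := hM C
      obtain ⟨Z, j, hZ, _⟩ := hM' C
      obtain ⟨t, ht⟩ := hi Z j hZ
      have : Mono (i ≫ t) := by rwa [ht]
      exact ⟨Y, i, hY, mono_of_mono i t, fun N hN g => hi N g hN, fun h => absurd h hC⟩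
  choose Y i hY hi hiN hiso using approx
  let b := coresolution i f
  have hb : ∀ k, Mono (b k).hom := by
    rintro (_ | k)
    · assumption
    · exact hi _
  have hbM : ∀ k, M (b k).right := by
    rintro (_ | k)
    · exact h₁
    · exact hY _
  let p : ∀ k, (b k).right ⟶ (b (k + 1)).left := fun k => cokernel.π (b k).hom
  have hp₀ : ∀ k, (b k).hom ≫ p k = 0 := fun k => cokernel.condition (b k).hom
  have hp : ∀ k, Epi (p k) := fun k => inferInstanceAs (Epi (cokernel.π (b k).hom))
  have hS : ∀ k, (ShortComplex.mk (b k).hom (p k) (hp₀ k)).ShortExact :=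
    fun k => cokernelSequence_shortExact (b k)
  have hiN' : ∀ k N, M N → ∀ g : (b (k + 1)).left ⟶ N, ∃ h, (b (k + 1)).hom ≫ h = g :=
    fun k => hiN _
  -- The map `f` need not be an approximation, so `Ext¹(C₁, N)` may survive. Dimension shifting
  -- moves this obstruction to degree `k` for `C_k`; at `k = n` it is outside the range.
  have hC : ∀ k, ∀ N, M N → ∀ j, 0 < j → j < n → j ≠ k → V j (b k).left N := by
    intro k
    induction k with
    | zero => exact fun N hN j hj hj' _ => hV.vanish h₀ hN j hj hj'
    | succ k ih =>
      intro N hN j hj hj' hjk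
      obtain _ | _ | j := j
      · lia
      · obtain _ | k := k
        · lia
        · exact hV.quotient_one (hS (k + 1)) N (hiN _ N hN) (hV.vanish (hbM _) hN 1 hj hj')
      · exact hV.quotient (hS k) (j + 1) N (ih N hN (j + 1) (by lia) (by lia) (by lia))
          (hV.vanish (hbM _) hN _ hj hj')
  have hCn : M (b n).left := hV.mem _ fun N hN j hj hj' => hC n N hN j hj hj' (by lia)
  -- In the second variable each cokernel costs one degree.
  have hT : ∀ k, ∀ T, M T → ∀ j, 0 < j → j + k < n → V j T (b k).left := by
    intro k
    induction k with
    | zero => exact fun T hT j hj hj' => hV.vanish hT h₀ j hj (by lia)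
    | succ k ih =>
      exact fun T hT j hj hj' => hV.to_quotient (hS k) j T (hV.vanish hT (hbM k) j hj (by lia))
        (ih T hT (j + 1) (by lia) (by lia))
  have hd : ∀ k, seqD (Functor.ofSequence (coresolutionD i f)) k = coresolutionD i f k :=
    Functor.ofSequence_map_homOfLE_succ _
  refine ⟨Functor.ofSequence (coresolutionD i f), ?_, Iso.refl _, Iso.refl _, ?_⟩
  · constructor
    · rintro (_ | k)
      · exact h₀
      · exact hbM k
    · intro k
      rw [hd, hd]
      have : (b k).hom ≫ p k ≫ (b (k + 1)).hom = 0 := by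
        rw [← Category.assoc, hp₀, zero_comp]
      obtain _ | k := k
      · exact this
      · change (p k ≫ (b (k + 1)).hom) ≫ p (k + 1) ≫ (b (k + 1 + 1)).hom = 0
        rw [Category.assoc, this, comp_zero]
    · rw [hd]
      assumption
    · intro k hk T hMT g hg
      rw [hd] at hg ⊢
      change T ⟶ (b k).right at g
      change g ≫ p k ≫ (b (k + 1)).hom = 0 at hg
      have hg' : g ≫ p k = 0 := by
        rw [← cancel_mono (b (k + 1)).hom, Category.assoc, hg, zero_comp]
      obtain ⟨g', hg''⟩ : ∃ g' : T ⟶ (b k).left, g' ≫ (b k).hom = g :=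
        ⟨(hS k).exact.lift g hg', (hS k).exact.lift_f g hg'⟩
      obtain _ | k := k
      · exact ⟨g', hg''⟩
      · obtain ⟨h, hh⟩ := hV.lift (hS k) T (hT k T hMT 1 one_pos (by lia)) g'
        change h ≫ p k = g' at hh
        refine ⟨h, ?_⟩
        change h ≫ p k ≫ (b (k + 1)).hom = g
        rw [← Category.assoc, hh, hg'']
    · rw [hd]
      obtain ⟨m, rfl⟩ : ∃ m, n = m + 1 := ⟨n - 1, by lia⟩
      have : IsIso (b (m + 1)).hom := hiso _ hCn
      exact inferInstanceAs (Epi (p m ≫ (b (m + 1)).hom))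
    · intro k T hMT g hg
      rw [hd] at hg ⊢
      change (b k).right ⟶ T at g
      have hg' : (b k).hom ≫ g = 0 := by
        obtain _ | k := k
        · exact hg
        · change (p k ≫ (b (k + 1)).hom) ≫ g = 0 at hg
          rw [← cancel_epi (p k), ← Category.assoc, hg, comp_zero]
      obtain ⟨g', hg''⟩ : ∃ g' : (b (k + 1)).left ⟶ T, p k ≫ g' = g :=
        ⟨cokernel.desc _ g hg', cokernel.π_desc _ g hg'⟩
      obtain ⟨h, hh⟩ := hiN' k T hMT g'
      refine ⟨h, ?_⟩
      change (p k ≫ (b (k + 1)).hom) ≫ h = g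
      rw [Category.assoc, hh, hg'']
  · rw [hd]
    exact (Category.id_comp _).trans (Category.comp_id _).symm

end Coresolution

/-! ### Cutting off sequences, and reversing those of the opposite category -/

section NExactSeqOfSequence

variable {A : Type u} [Category.{v} A] [Abelian A] {M : ObjectProperty A} {n : ℕ}

/-- The first `n + 2` terms of a sequence. -/
abbrev truncation (F : ℕ ⥤ A) (h : ∀ k, M (F.obj k)) : ComposableArrows M.FullSubcategory (n + 1) :=
  (show Monotone (fun i : Fin (n + 1 + 1) => (i : ℕ)) from fun _ _ h => h).functor ⋙ M.lift F h

lemma IsNExactFor.isNExact_truncation {F : ℕ ⥤ A} (hF : IsNExactFor M n F) :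
    IsNExact (truncation (n := n) F hF.prop) where
  zero i _ := M.ι.map_injective (hF.zero i)
  mono := M.ι.mono_of_mono_map hF.mono
  lift i hi X g hg := by
    obtain ⟨h, hh⟩ := hF.lift i (by lia) X.obj X.property g.hom (congrArg M.ι.map hg)
    exact ⟨M.homMk h, M.ι.map_injective hh⟩
  epi := M.ι.epi_of_epi_map hF.epi
  desc i _ X g hg := by
    obtain ⟨h, hh⟩ := hF.desc i X.obj X.property g.hom (congrArg M.ι.map hg)
    exact ⟨M.homMk h, M.ι.map_injective hh⟩

/-- The first `n + 2` terms of a sequence in the opposite category, in reverse order. -/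
abbrev opTruncation (F : ℕ ⥤ Aᵒᵖ) (h : ∀ k, M.op (F.obj k)) :
    ComposableArrows M.FullSubcategory (n + 1) :=
  (show Monotone (fun i : Fin (n + 1 + 1) => OrderDual.toDual (n + 1 - (i : ℕ))) from
    fun _ _ h => Nat.sub_le_sub_left (show (_ : ℕ) ≤ _ from h) (n + 1)).functor ⋙
    (orderDualEquivalence ℕ).functor ⋙ M.lift F.leftOp fun k => h k.unop

lemma IsNExactFor.isNExact_opTruncation {F : ℕ ⥤ Aᵒᵖ} (hF : IsNExactFor M.op n F) :
    IsNExact (opTruncation (M := M) (n := n) F hF.prop) := by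
  -- Reversed indices `n + 1 - i` are consecutive only up to a propositional equality, so the axioms
  -- are first restated for arbitrary indices with equations.
  have zero' : ∀ a b c (hab : a ≤ b) (hbc : b ≤ c), b = a + 1 → c = b + 1 →
      F.map (homOfLE hab) ≫ F.map (homOfLE hbc) = 0 := by
    rintro a _ _ _ _ rfl rfl
    exact hF.zero a
  have lift' : ∀ a b c (hab : a ≤ b) (hbc : b ≤ c), b = a + 1 → c = b + 1 → a + 1 ≤ n →
      ∀ T, M.op T → ∀ g : T ⟶ F.obj b, g ≫ F.map (homOfLE hbc) = 0 →
        ∃ h : T ⟶ F.obj a, h ≫ F.map (homOfLE hab) = g := by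
    rintro a _ _ _ _ rfl rfl
    exact hF.lift a
  have desc' : ∀ a b c (hab : a ≤ b) (hbc : b ≤ c), b = a + 1 → c = b + 1 →
      ∀ T, M.op T → ∀ g : F.obj b ⟶ T, F.map (homOfLE hab) ≫ g = 0 →
        ∃ h : F.obj c ⟶ T, F.map (homOfLE hbc) ≫ h = g := by
    rintro a _ _ _ _ rfl rfl
    exact hF.desc a
  have mono' : ∀ a b (hab : a ≤ b), a = 0 → b = 1 → Mono (F.map (homOfLE hab)) := by
    rintro _ _ _ rfl rfl
    exact hF.mono
  have epi' : ∀ a b (hab : a ≤ b), a = n → b = n + 1 → Epi (F.map (homOfLE hab)) := by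
    rintro _ _ _ rfl rfl
    exact hF.epi
  constructor
  · intro i hi
    apply M.ι.map_injective
    exact congrArg Quiver.Hom.unop (zero' (n + 1 - (i + 2)) (n + 1 - (i + 1)) (n + 1 - i)
      (by lia) (by lia) (by lia) (by lia))
  · apply M.ι.mono_of_mono_map
    have := epi' (n + 1 - 1) (n + 1 - 0) (by lia) (by lia) (by lia)
    exact unop_mono_of_epi (F.map (homOfLE (show n + 1 - 1 ≤ n + 1 - 0 by lia)))
  · intro i hi X g hg
    obtain ⟨h, hh⟩ := desc' (n + 1 - (i + 2)) (n + 1 - (i + 1)) (n + 1 - i)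
      (by lia) (by lia) (by lia) (by lia) (op X.obj) X.property g.hom.op
      (congrArg (fun t => (M.ι.map t).op) hg)
    exact ⟨M.homMk h.unop, M.ι.map_injective (congrArg Quiver.Hom.unop hh)⟩
  · apply M.ι.epi_of_epi_map
    have := mono' (n + 1 - (n + 1)) (n + 1 - n) (by lia) (by lia) (by lia)
    exact unop_epi_of_mono (F.map (homOfLE (show n + 1 - (n + 1) ≤ n + 1 - n by lia)))
  · intro i hi X g hg
    obtain ⟨h, hh⟩ := lift' (n + 1 - (i + 2)) (n + 1 - (i + 1)) (n + 1 - i)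
      (by lia) (by lia) (by lia) (by lia) (by lia) (op X.obj) X.property g.hom.op
      (congrArg (fun t => (M.ι.map t).op) hg)
    exact ⟨M.homMk h.unop, M.ι.map_injective (congrArg Quiver.Hom.unop hh)⟩

lemma firstMono_essSurj (hM : IsGenerating M) (hn : 1 ≤ n) {V : ℕ → A → A → Prop}
    (hV : IsVanishing M n V) (hcov : IsCovariantlyFinite M) (hcog : IsCogenerating M) :
    (firstMono hM n).EssSurj where
  mem_essImage f := by
    have : Mono (Arrow.mk (M.ι.map f.obj.hom)).hom := f.property
    obtain ⟨F, hF, e₀, e₁, he⟩ := exists_isNExactFor hn hV hcov hcog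
      (Arrow.mk (M.ι.map f.obj.hom)) f.obj.left.property f.obj.right.property
    let S : NExactSeq M.FullSubcategory n := ⟨_, hF.isNExact_truncation⟩
    let e₀' : ((firstMono hM n).obj S).obj.left ≅ f.obj.left := M.isoMk e₀
    let e₁' : ((firstMono hM n).obj S).obj.right ≅ f.obj.right := M.isoMk e₁
    exact ⟨S, ⟨ObjectProperty.isoMk _ (Arrow.isoMk e₀' e₁' (M.ι.map_injective he))⟩⟩

/-- An epimorphism becomes a monomorphism in `Aᵒᵖ`, and right approximations become left ones; the
sequence constructed there is read backwards. -/
lemma lastEpi_essSurj (hM : IsCogenerating M) (hn : 1 ≤ n) {V : ℕ → Aᵒᵖ → Aᵒᵖ → Prop}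
    (hV : IsVanishing M.op n V) (hcon : IsContravariantlyFinite M) (hgen : IsGenerating M) :
    (lastEpi hM n).EssSurj where
  mem_essImage f := by
    have hcov : IsCovariantlyFinite M.op := fun X => by
      obtain ⟨Y, p, hY, hp⟩ := hcon X.unop
      refine ⟨op Y, p.op, hY, fun Z g hZ => ?_⟩
      obtain ⟨h, hh⟩ := hp Z.unop g.unop hZ
      exact ⟨h.op, congrArg Quiver.Hom.op hh⟩
    have hcog : IsCogenerating M.op := fun X => by
      obtain ⟨Y, p, hY, _⟩ := hgen X.unop
      exact ⟨op Y, p.op, hY, inferInstance⟩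
    have hf : Epi (M.ι.map f.obj.hom) := f.property
    have : Mono (Arrow.mk (M.ι.map f.obj.hom).op).hom :=
      inferInstanceAs (Mono (M.ι.map f.obj.hom).op)
    obtain ⟨F, hF, e₀, e₁, he⟩ := exists_isNExactFor hn hV hcov hcog
      (Arrow.mk (M.ι.map f.obj.hom).op) f.obj.right.property f.obj.left.property
    have key : ∀ a b (hab : a ≤ b), a = 0 → b = 1 →
        ∃ (i₀ : F.obj a ≅ op f.obj.right.obj) (i₁ : F.obj b ≅ op f.obj.left.obj),
          i₀.hom ≫ (M.ι.map f.obj.hom).op = F.map (homOfLE hab) ≫ i₁.hom := by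
      rintro _ _ _ rfl rfl
      exact ⟨e₀, e₁, he⟩
    obtain ⟨i₀, i₁, hi⟩ := key (n + 1 - (n + 1)) (n + 1 - n) (by lia) (by lia) (by lia)
    let S : NExactSeq M.FullSubcategory n := ⟨_, hF.isNExact_opTruncation⟩
    let e₀' : f.obj.left ≅ ((lastEpi hM n).obj S).obj.left := M.isoMk i₁.unop
    let e₁' : f.obj.right ≅ ((lastEpi hM n).obj S).obj.right := M.isoMk i₀.unop
    refine ⟨S, ⟨(ObjectProperty.isoMk _ (Arrow.isoMk e₀' e₁' (M.ι.map_injective ?_))).symm⟩⟩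
    exact (congrArg Quiver.Hom.unop hi).symm

end NExactSeqOfSequence

/-! ### Vanishing of `Ext` and `n`-cluster tilting subcategories -/

section ExtVanishing

open Abelian

variable {A : Type u} [Category.{v} A] [Abelian A] [HasExt.{w} A] {S : ShortComplex A}

lemma subsingleton_ext_X₃_left (hS : S.ShortExact) (i : ℕ) (N : A)
    (h₁ : Subsingleton (Ext.{w} S.X₁ N i)) (h₂ : Subsingleton (Ext.{w} S.X₂ N (i + 1))) :
    Subsingleton (Ext.{w} S.X₃ N (i + 1)) := by
  refine subsingleton_of_forall_eq 0 fun x => ?_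
  obtain ⟨y, rfl⟩ := Ext.contravariant_sequence_exact₃ hS N x (Subsingleton.elim _ _)
    (add_comm 1 i)
  rw [Subsingleton.elim y 0, Ext.comp_zero]

/-- Every class is the extension class composed with some `g : S.X₁ ⟶ N`. Since `g` extends along
`S.f`, and the extension class composed with `S.f` is zero, the class vanishes. -/
lemma subsingleton_ext_one_X₃_left (hS : S.ShortExact) (N : A)
    (h₁ : ∀ g : S.X₁ ⟶ N, ∃ h : S.X₂ ⟶ N, S.f ≫ h = g)
    (h₂ : Subsingleton (Ext.{w} S.X₂ N 1)) : Subsingleton (Ext.{w} S.X₃ N 1) := by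
  refine subsingleton_of_forall_eq 0 fun x => ?_
  obtain ⟨y, rfl⟩ := Ext.contravariant_sequence_exact₃ hS N x (Subsingleton.elim _ _)
    (add_zero 1)
  obtain ⟨g, rfl⟩ := Ext.homEquiv₀.symm.surjective y
  obtain ⟨h, rfl⟩ := h₁ g
  change hS.extClass.comp (Ext.mk₀ _) _ = 0
  rw [← Ext.mk₀_comp_mk₀, ShortComplex.ShortExact.extClass_comp_assoc]

lemma subsingleton_ext_X₃_right (hS : S.ShortExact) (i : ℕ) (T : A)
    (h₂ : Subsingleton (Ext.{w} T S.X₂ i)) (h₁ : Subsingleton (Ext.{w} T S.X₁ (i + 1))) :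
    Subsingleton (Ext.{w} T S.X₃ i) := by
  refine subsingleton_of_forall_eq 0 fun x => ?_
  obtain ⟨y, rfl⟩ := Ext.covariant_sequence_exact₃ T hS x rfl (Subsingleton.elim _ _)
  rw [Subsingleton.elim y 0, Ext.zero_comp]

lemma exists_lift_of_subsingleton_ext (hS : S.ShortExact) (T : A)
    (h₁ : Subsingleton (Ext.{w} T S.X₁ 1)) (g : T ⟶ S.X₃) : ∃ h : T ⟶ S.X₂, h ≫ S.g = g := by
  obtain ⟨y, hy⟩ := Ext.covariant_sequence_exact₃ T hS (Ext.mk₀ g) (zero_add 1)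
    (Subsingleton.elim _ _)
  obtain ⟨h, rfl⟩ := Ext.homEquiv₀.symm.surjective y
  refine ⟨h, ?_⟩
  change (Ext.mk₀ h).comp _ _ = _ at hy
  rw [Ext.mk₀_comp_mk₀] at hy
  exact (Ext.mk₀_bijective T S.X₃).1 hy

lemma subsingleton_ext_X₁_right (hS : S.ShortExact) (i : ℕ) (T : A)
    (h₃ : Subsingleton (Ext.{w} T S.X₃ i)) (h₂ : Subsingleton (Ext.{w} T S.X₂ (i + 1))) :
    Subsingleton (Ext.{w} T S.X₁ (i + 1)) := by
  refine subsingleton_of_forall_eq 0 fun x => ?_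
  obtain ⟨y, rfl⟩ := Ext.covariant_sequence_exact₁ T hS x (Subsingleton.elim _ _) rfl
  rw [Subsingleton.elim y 0, Ext.zero_comp]

lemma subsingleton_ext_one_X₁_right (hS : S.ShortExact) (T : A)
    (h₃ : ∀ g : T ⟶ S.X₃, ∃ h : T ⟶ S.X₂, h ≫ S.g = g)
    (h₂ : Subsingleton (Ext.{w} T S.X₂ 1)) : Subsingleton (Ext.{w} T S.X₁ 1) := by
  refine subsingleton_of_forall_eq 0 fun x => ?_
  obtain ⟨y, rfl⟩ := Ext.covariant_sequence_exact₁ T hS x (Subsingleton.elim _ _) (zero_add 1)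
  obtain ⟨g, rfl⟩ := Ext.homEquiv₀.symm.surjective y
  obtain ⟨h, rfl⟩ := h₃ g
  change (Ext.mk₀ _).comp hS.extClass _ = 0
  rw [← Ext.mk₀_comp_mk₀_assoc, ShortComplex.ShortExact.comp_extClass, Ext.comp_zero]

lemma subsingleton_ext_X₁_left (hS : S.ShortExact) (i : ℕ) (N : A)
    (h₂ : Subsingleton (Ext.{w} S.X₂ N i)) (h₃ : Subsingleton (Ext.{w} S.X₃ N (i + 1))) :
    Subsingleton (Ext.{w} S.X₁ N i) := by
  refine subsingleton_of_forall_eq 0 fun x => ?_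
  obtain ⟨y, rfl⟩ := Ext.contravariant_sequence_exact₁ hS N x (add_comm 1 i)
    (Subsingleton.elim _ _)
  rw [Subsingleton.elim y 0, Ext.comp_zero]

lemma exists_desc_of_subsingleton_ext (hS : S.ShortExact) (N : A)
    (h₃ : Subsingleton (Ext.{w} S.X₃ N 1)) (g : S.X₁ ⟶ N) : ∃ h : S.X₂ ⟶ N, S.f ≫ h = g := by
  obtain ⟨y, hy⟩ := Ext.contravariant_sequence_exact₁ hS N (Ext.mk₀ g) (add_zero 1)
    (Subsingleton.elim _ _)
  obtain ⟨h, rfl⟩ := Ext.homEquiv₀.symm.surjective y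
  refine ⟨h, ?_⟩
  change (Ext.mk₀ S.f).comp (Ext.mk₀ h) _ = _ at hy
  rw [Ext.mk₀_comp_mk₀] at hy
  exact (Ext.mk₀_bijective S.X₁ N).1 hy

end ExtVanishing

section ClusterTilting

variable {A : Type u} [Category.{v} A] [Abelian A] {M : ObjectProperty A} {n : ℕ}

/-- The vanishing of `Extⁱ(X, Y)`. -/
def ExtZero (i : ℕ) (X Y : A) : Prop :=
  letI := HasExt.standard A
  Subsingleton (Abelian.Ext X Y i)

lemma IsNClusterTilting.isVanishing (hM : IsNClusterTilting M n) : IsVanishing M n ExtZero :=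
  letI := HasExt.standard A
  { vanish := fun X Y hX hY => (hM.mem_iff_left X).1 hX Y hY
    mem := fun X h => (hM.mem_iff_left X).2 h
    quotient := fun _ hS => subsingleton_ext_X₃_left hS
    quotient_one := fun _ hS => subsingleton_ext_one_X₃_left hS
    to_quotient := fun _ hS => subsingleton_ext_X₃_right hS
    lift := fun _ hS => exists_lift_of_subsingleton_ext hS }

/-- The relation on `Aᵒᵖ` is vanishing of `Ext` in `A` with its arguments exchanged, so `Ext` groups
of the opposite category do not enter. -/
lemma IsNClusterTilting.isVanishing_op (hM : IsNClusterTilting M n) :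
    IsVanishing M.op n (fun i X Y => ExtZero i Y.unop X.unop) :=
  letI := HasExt.standard A
  { vanish := fun X Y hX hY => (hM.mem_iff_left Y.unop).1 hY X.unop hX
    mem := fun X h => (hM.mem_iff_right X.unop).2 fun Y hY => h (op Y) hY
    quotient := fun _ hS i N => subsingleton_ext_X₁_right hS.unop i N.unop
    quotient_one := fun _ hS N h => subsingleton_ext_one_X₁_right hS.unop N.unop fun g => by
      obtain ⟨k, hk⟩ := h g.op
      exact ⟨k.unop, congrArg Quiver.Hom.unop hk⟩
    to_quotient := fun _ hS i T => subsingleton_ext_X₁_left hS.unop i T.unop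
    lift := fun _ hS T h g => by
      obtain ⟨k, hk⟩ := exists_desc_of_subsingleton_ext hS.unop T.unop h g.unop
      exact ⟨k.op, congrArg Quiver.Hom.op hk⟩ }

lemma IsNClusterTilting.prop_of_projective (hM : IsNClusterTilting M n) (P : A)
    (_ : Projective P) : M P := by
  rw [hM.mem_iff_left]
  intro Y _ i hi _
  obtain ⟨i, rfl⟩ : ∃ j, i = j + 1 := ⟨i - 1, by lia⟩
  let := HasExt.standard A
  exact Abelian.Ext.subsingleton_of_projective P Y i

lemma IsNClusterTilting.prop_of_injective (hM : IsNClusterTilting M n) (I : A)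
    (_ : Injective I) : M I := by
  rw [hM.mem_iff_right]
  intro X _ i hi _
  obtain ⟨i, rfl⟩ : ∃ j, i = j + 1 := ⟨i - 1, by lia⟩
  let := HasExt.standard A
  exact Abelian.Ext.subsingleton_of_injective X I i

lemma IsNClusterTilting.prop_of_isZero (hM : IsNClusterTilting M n) {O : A} (hO : IsZero O) :
    M O :=
  hM.prop_of_projective O ⟨fun _ _ _ => ⟨0, hO.eq_of_src _ _⟩⟩

lemma IsNClusterTilting.prop_biprod (hM : IsNClusterTilting M n) {X Y : A} (hX : M X) (hY : M Y) :
    M (X ⊞ Y) := by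
  rw [hM.mem_iff_left] at hX hY ⊢
  intro N hN i hi hi'
  let := HasExt.standard A
  have h₁ := hX N hN i hi hi'
  have h₂ := hY N hN i hi hi'
  exact (Abelian.Ext.biprodAddEquiv (X₁ := X) (X₂ := Y) (Y := N) (n := i)).toEquiv.subsingleton

lemma IsNClusterTilting.hasBinaryBiproducts (hM : IsNClusterTilting M n) :
    HasBinaryBiproducts M.FullSubcategory where
  has_binary_biproduct X Y := by
    let b : BinaryBicone X Y :=
      { pt := ⟨X.obj ⊞ Y.obj, hM.prop_biprod X.property Y.property⟩
        fst := M.homMk biprod.fst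
        snd := M.homMk biprod.snd
        inl := M.homMk biprod.inl
        inr := M.homMk biprod.inr
        inl_fst := M.ι.map_injective biprod.inl_fst
        inl_snd := M.ι.map_injective biprod.inl_snd
        inr_fst := M.ι.map_injective biprod.inr_fst
        inr_snd := M.ι.map_injective biprod.inr_snd }
    exact HasBinaryBiproduct.mk ⟨b, isBinaryBilimitOfTotal b (M.ι.map_injective biprod.total)⟩

end ClusterTilting

/-! ### The equivalences -/

section Equivalences

variable {A : Type u} [Category.{v} A] [Abelian A] {M : ObjectProperty A} {n : ℕ}

instance firstMono_additive (hM : IsGenerating M) : (firstMono hM n).Additive where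
  map_add {_ _ _ _} := by
    ext1
    exact Arrow.hom_ext _ _ rfl rfl

instance lastEpi_additive (hM : IsCogenerating M) : (lastEpi hM n).Additive where
  map_add {_ _ _ _} := by
    ext1
    exact Arrow.hom_ext _ _ rfl rfl

/-- Both sides are factorization conditions on the outer components of one ladder, and the transfer
of null-homotopies along `n`-exact sequences links them. This is the source of the duality. -/
lemma Theta_lastEpi_map_eq_zero_iff (hM : IsGenerating M) (hM' : IsCogenerating M)
    {S T : NExactSeq M.FullSubcategory n} (φ : S ⟶ T) :
    (lastEpi hM' n ⋙ Theta M).map φ = 0 ↔ (firstMono hM n ⋙ coTheta M).map φ = 0 :=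
  (Theta_map_eq_zero_iff ((lastEpi hM' n).map φ)).trans
    ((S.property.exists_homotopy_iff T.property φ.hom).symm.trans
      (coTheta_map_eq_zero_iff ((firstMono hM n).map φ)).symm)

/-- The main result for an abelian category with enough projective and injective objects. -/
lemma main_of_enough [EnoughProjectives A] [EnoughInjectives A] (hn : 1 ≤ n)
    (hM : IsNClusterTilting M n) :
    ((Theta M).Additive ∧ (Theta M).Full ∧ (Theta M).EssSurj ∧ IsObjective (Theta M)) ∧
    (IsAbelianCategory (QuotientByIdeal (genV M)) ∧ IsAbelianCategory (StableRightMod M) ∧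
      IsAbelianCategory (StableLeftMod M)ᵒᵖ ∧ IsAbelianCategory (QuotientByIdeal (genV' M))) ∧
    ((firstMono hM.generating n).Full ∧ (firstMono hM.generating n).EssSurj ∧
      (lastEpi hM.cogenerating n).Full ∧ (lastEpi hM.cogenerating n).EssSurj) ∧
    ∃ (Ψ : MonoCat M ⥤ StableRightMod M) (Ψ' : EpiCat M ⥤ (StableLeftMod M)ᵒᵖ)
      (eΨ : QuotientByIdeal (genV M) ≌ StableRightMod M)
      (eΘ : QuotientByIdeal (genV' M) ≌ StableRightMod M)
      (eΨ' : QuotientByIdeal (genV' M) ≌ (StableLeftMod M)ᵒᵖ)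
      (Sig : StableRightMod M ≌ (StableLeftMod M)ᵒᵖ),
      IsPsi hM.generating hM.cogenerating n Ψ ∧ IsPsi' hM.generating hM.cogenerating n Ψ' ∧
      Nonempty (toQuotient (genV M) ⋙ eΨ.functor ≅ Ψ) ∧
      Nonempty (toQuotient (genV' M) ⋙ eΘ.functor ≅ Theta M) ∧
      Nonempty (toQuotient (genV' M) ⋙ eΨ'.functor ≅ Ψ') ∧
      Nonempty (Sig.functor ≅ eΘ.inverse ⋙ eΨ'.functor) := by
  have := hM.hasBinaryBiproducts
  have := Theta_essSurj hM.prop_of_projective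
  have := coTheta_essSurj hM.prop_of_injective
  have := firstMono_full hM.generating n
  have := lastEpi_full hM.cogenerating n
  have := firstMono_essSurj hM.generating hn hM.isVanishing hM.covariantlyFinite hM.cogenerating
  have := lastEpi_essSurj hM.cogenerating hn hM.isVanishing_op hM.contravariantlyFinite
    hM.generating
  let O : M.FullSubcategory := ⟨_, hM.prop_of_isZero (isZero_zero A)⟩
  have hO : IsZero O.obj := isZero_zero A
  obtain ⟨eΘ, ⟨iΘ⟩⟩ := exists_quotient_equivalence (genV' M) (Theta M)
    fun _ _ => Theta_map_eq_zero_iff_mem_idealHom hO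
  obtain ⟨eC, ⟨iC⟩⟩ := exists_quotient_equivalence (genV M) (coTheta M)
    fun _ _ => coTheta_map_eq_zero_iff_mem_idealHom hO
  obtain ⟨Sig, ⟨iS⟩⟩ := exists_equivalence_of_map_eq_iff
    (lastEpi hM.cogenerating n ⋙ Theta M) (firstMono hM.generating n ⋙ coTheta M) (by
      intro S T f g
      rw [← sub_eq_zero, ← Functor.map_sub, Theta_lastEpi_map_eq_zero_iff hM.generating,
        Functor.map_sub, sub_eq_zero])
  have hR : IsAbelianCategory (StableRightMod M) :=
    isAbelianCategory_stableRightMod (hasWeakPushouts_op hM.contravariantlyFinite) O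
  refine ⟨⟨inferInstance, inferInstance, inferInstance, Theta_isObjective⟩,
    ⟨hR.of_equivalence (eC.trans Sig.symm), hR, hR.of_equivalence Sig.symm,
      hR.of_equivalence eΘ⟩,
    ⟨inferInstance, inferInstance, inferInstance, inferInstance⟩,
    -- With these choices, both defining properties of `Ψ` and `Ψ'` reduce to the single comparison
    -- isomorphism `iS`.
    coTheta M ⋙ Sig.inverse, Theta M ⋙ Sig.functor, eC.trans Sig.symm, eΘ, eΘ.trans Sig, Sig,
    ⟨?_⟩, ⟨?_⟩, ⟨?_⟩, ⟨iΘ⟩, ⟨?_⟩, ⟨?_⟩⟩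
  · exact (Functor.associator _ _ _).symm ≪≫ Functor.isoWhiskerRight iS.symm Sig.inverse ≪≫
      Functor.associator _ _ _ ≪≫
      Functor.isoWhiskerLeft _ Sig.unitIso.symm ≪≫ Functor.rightUnitor _
  · exact (Functor.associator _ _ _).symm ≪≫ iS
  · exact (Functor.associator _ _ _).symm ≪≫ Functor.isoWhiskerRight iC Sig.inverse
  · exact (Functor.associator _ _ _).symm ≪≫ Functor.isoWhiskerRight iΘ Sig.functor
  · exact (Functor.leftUnitor _).symm ≪≫ Functor.isoWhiskerRight eΘ.counitIso.symm Sig.functor ≪≫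
      Functor.associator _ _ _

end Equivalences

/-! ### Finitely generated modules over an artin algebra -/

section Finiteness

variable (k : Type*) {R E : Type*} [CommRing k] [Ring R] [Algebra k R] [AddCommGroup E]
  [Module k E] [Module R E] [IsScalarTower k R E]

/-- The elements of a module which are annihilated by a left ideal, as a module over a central
subring. -/
def annihilated (E : Type*) [AddCommGroup E] [Module k E] [Module R E] [IsScalarTower k R E]
    (J : Ideal R) : Submodule k E where
  carrier := {y | ∀ a ∈ J, a • y = 0}
  add_mem' hx hy a ha := by rw [smul_add, hx a ha, hy a ha, add_zero]
  zero_mem' a _ := smul_zero a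
  smul_mem' c x hx a ha := by
    rw [← algebraMap_smul R c x, ← mul_smul, ← Algebra.commutes, mul_smul, hx a ha, smul_zero]

/-- A module over a finite algebra is finite if the elements annihilated by the Jacobson radical
form a finite submodule. -/
lemma finite_of_fg_annihilated_jacobson [IsNoetherianRing k] [Module.Finite k R]
    [IsSemiprimaryRing R] (h : (annihilated k E (Ring.jacobson R)).FG) : Module.Finite k E := by
  obtain ⟨N, hN⟩ := IsSemiprimaryRing.isNilpotent (R := R)
  set J := Ring.jacobson R
  obtain ⟨m, r, hr⟩ := Submodule.fg_iff_exists_fin_generating_family.1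
    (IsNoetherian.noetherian (J.restrictScalars k))
  have hrJ : ∀ j, r j ∈ J := fun j => by
    have : r j ∈ J.restrictScalars k := hr ▸ Submodule.subset_span ⟨j, rfl⟩
    exact this
  -- Multiplication by generators of `J` sends the elements killed by `J ^ (i + 1)` to tuples of
  -- elements killed by `J ^ i`, and its kernel consists of elements killed by `J`. Induction on `i`
  -- ends at `J ^ N = 0`.
  let Φ : E →ₗ[k] (Fin m → E) := LinearMap.pi fun j => Algebra.lsmul k k E (r j)
  have key : ∀ i : ℕ, (annihilated k E (J ^ i)).FG := by
    intro i
    induction i with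
    | zero =>
      convert Submodule.fg_bot
      rw [eq_bot_iff]
      intro y hy
      have := hy 1 (by rw [Submodule.pow_zero, Ideal.one_eq_top]; trivial)
      simpa using this
    | succ i ih =>
      refine Submodule.fg_of_fg_map_of_fg_inf_ker Φ ?_ (h.of_le ?_)
      · refine (Submodule.fg_pi (fun _ : Fin m => ih)).of_le ?_
        rintro _ ⟨y, hy, rfl⟩ j - a ha
        change a • r j • y = 0
        rw [← mul_smul]
        refine hy _ ?_
        rw [Submodule.pow_succ]
        exact Ideal.mul_mem_mul ha (hrJ j)
      · rintro y ⟨-, hy⟩ a ha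
        have ha' : a ∈ Submodule.span k (Set.range r) := by
          rw [hr]
          exact ha
        clear ha
        induction ha' using Submodule.span_induction with
        | mem x hx =>
          obtain ⟨j, rfl⟩ := hx
          exact congrFun hy j
        | zero => exact zero_smul R y
        | add x x' _ _ hx hx' => rw [add_smul, hx, hx', add_zero]
        | smul c x _ hx => rw [smul_assoc, hx, smul_zero]
  have htop : annihilated k E (J ^ N) = ⊤ := by
    rw [eq_top_iff]
    intro y _ a ha
    rw [hN] at ha
    rw [(Submodule.mem_bot R).1 ha, zero_smul]
  exact ⟨htop ▸ key N⟩

end Finiteness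

/-! ### Essential extensions and injective hulls -/

section InjectiveEnvelope

variable {R I : Type*} [Ring R] [AddCommGroup I] [Module R I]

/-- `E` is an essential extension of `X` inside the module `I`. -/
def IsEssentialExtension (X E : Submodule R I) : Prop :=
  X ≤ E ∧ ∀ e ∈ E, Submodule.span R {e} ⊓ X = ⊥ → e = 0

lemma IsEssentialExtension.refl (X : Submodule R I) : IsEssentialExtension X X := by
  refine ⟨le_rfl, fun e he h => ?_⟩
  have : e ∈ Submodule.span R {e} ⊓ X := ⟨Submodule.mem_span_singleton_self e, he⟩
  rwa [h] at this

/-- Essentiality is tested on one element at a time, so it passes to unions of chains and Zorn's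
lemma applies. -/
lemma exists_maximal_isEssentialExtension (X : Submodule R I) :
    ∃ E, Maximal (IsEssentialExtension X) E := by
  obtain ⟨E, -, hE⟩ := zorn_le_nonempty₀ {E | IsEssentialExtension X E} (fun c hc hchain y hy => by
    refine ⟨sSup c, ⟨(hc hy).1.trans (le_sSup hy), fun e he h => ?_⟩, fun z hz => le_sSup hz⟩
    obtain ⟨E, hE, heE⟩ := (Submodule.mem_sSup_of_directed ⟨y, hy⟩ hchain.directedOn).1 he
    exact (hc hE).2 e heE h) X (IsEssentialExtension.refl X)
  exact ⟨E, hE⟩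

lemma exists_maximal_disjoint (E : Submodule R I) : ∃ C, Maximal (fun C => C ⊓ E = ⊥) C := by
  obtain ⟨C, -, hC⟩ := zorn_le_nonempty₀ {C : Submodule R I | C ⊓ E = ⊥} (fun c hc hchain y hy => by
    refine ⟨sSup c, ?_, fun z hz => le_sSup hz⟩
    change sSup c ⊓ E = ⊥
    rw [eq_bot_iff]
    rintro e ⟨he, heE⟩
    obtain ⟨C, hC, heC⟩ := (Submodule.mem_sSup_of_directed ⟨y, hy⟩ hchain.directedOn).1 he
    rw [← hc hC]
    exact ⟨heC, heE⟩) ⊥ (bot_inf_eq E)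
  exact ⟨C, hC⟩

end InjectiveEnvelope

section InjectiveEnvelope

variable {R I : Type u} [Ring R] [AddCommGroup I] [Module R I] [Module.Injective R I]
  {X E : Submodule R I}

/-- A maximal essential extension inside an injective module is a direct summand. -/
lemma exists_retraction_of_maximal (hE : Maximal (IsEssentialExtension X) E) :
    ∃ r : I →ₗ[R] E, ∀ e : E, r e = e := by
  obtain ⟨C, hC⟩ := exists_maximal_disjoint E
  let j : E →ₗ[R] I ⧸ C := C.mkQ ∘ₗ E.subtype
  have hj : Function.Injective j := by
    rw [injective_iff_map_eq_zero]
    intro e he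
    have h1 : (e : I) ∈ C := (Submodule.Quotient.mk_eq_zero C).1 he
    have h2 : (e : I) ∈ C ⊓ E := ⟨h1, e.2⟩
    rw [hC.prop] at h2
    exact Subtype.ext h2
  -- The image of `E` is essential in `I ⧸ C`: otherwise the span of a lift of `z` could be added to
  -- `C` without meeting `E`.
  have hess : ∀ z : I ⧸ C, z ≠ 0 → ∃ (s : R) (e : E), e ≠ 0 ∧ s • z = j e := by
    intro z hz
    obtain ⟨y, rfl⟩ := C.mkQ_surjective z
    by_contra! hcon
    apply hz
    have h1 : (C ⊔ Submodule.span R {y}) ⊓ E = ⊥ := by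
      rw [eq_bot_iff]
      rintro e ⟨he, heE⟩
      obtain ⟨c, hc, t, ht, rfl⟩ := Submodule.mem_sup.1 he
      obtain ⟨s, rfl⟩ := Submodule.mem_span_singleton.1 ht
      by_contra hne
      refine hcon s ⟨_, heE⟩ (fun h => hne (congrArg Subtype.val h)) ?_
      change _ = C.mkQ (c + s • y)
      rw [map_add, map_smul, Submodule.mkQ_apply C c, (Submodule.Quotient.mk_eq_zero C).2 hc,
        zero_add]
    have h2 := hC.le_of_ge h1 le_sup_left
    exact (Submodule.Quotient.mk_eq_zero C).2
      (h2 (Submodule.mem_sup_right (Submodule.mem_span_singleton_self y)))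
  obtain ⟨φ, hφ⟩ := Module.Injective.out j hj E.subtype
  -- The range of `φ` contains `E` and is still essential over `X`, so maximality forces it to equal
  -- `E`; thus `φ` induces the retraction.
  have hrange : IsEssentialExtension X (LinearMap.range φ) := by
    refine ⟨fun x hx => ⟨j ⟨x, hE.prop.1 hx⟩, hφ _⟩, ?_⟩
    rintro _ ⟨z, rfl⟩ h
    by_contra hne
    obtain ⟨s, e, he, hse⟩ := hess z (fun h => hne (by rw [h, map_zero]))
    apply he
    have hs : s • φ z = e := by
      rw [← map_smul, hse]
      exact hφ e
    refine Subtype.ext (hE.prop.2 e e.2 ?_)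
    rw [eq_bot_iff, ← h]
    refine inf_le_inf_right X ?_
    rw [Submodule.span_singleton_le_iff_mem, ← hs]
    exact Submodule.smul_mem _ s (Submodule.mem_span_singleton_self _)
  have hle : LinearMap.range φ ≤ E := hE.le_of_ge hrange fun e he => ⟨j ⟨e, he⟩, hφ _⟩
  exact ⟨(φ.codRestrict E fun z => hle ⟨z, rfl⟩) ∘ₗ C.mkQ, fun e => Subtype.ext (hφ e)⟩

lemma injective_of_maximal (hE : Maximal (IsEssentialExtension X) E) : Module.Injective R E where
  out _ _ _ _ _ _ f hf g := by
    obtain ⟨r, hr⟩ := exists_retraction_of_maximal hE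
    obtain ⟨h, hh⟩ := Module.Injective.out f hf (E.subtype ∘ₗ g)
    refine ⟨r ∘ₗ h, fun x => ?_⟩
    rw [LinearMap.comp_apply, hh]
    exact hr (g x)

end InjectiveEnvelope

section InjectiveEnvelope

variable {R I : Type*} [Ring R] [AddCommGroup I] [Module R I] {X E : Submodule R I}

/-- The socle of an essential extension of `X` is contained in `X`. -/
lemma IsEssentialExtension.mem_of_jacobson_smul_eq_zero [IsSemiprimaryRing R]
    (hE : IsEssentialExtension X E) {e : I} (he : e ∈ E) (h : ∀ a ∈ Ring.jacobson R, a • e = 0) :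
    e ∈ X := by
  let N : Submodule R I := Submodule.span R {e}
  -- The cyclic module generated by `e` is a module over the semisimple quotient by the radical, so
  -- its intersection with `X` has a complement, which essentiality forces to be zero.
  have hN : Module.IsTorsionBySet R N (Ring.jacobson R) := by
    rintro ⟨x, hx⟩ ⟨a, ha⟩
    obtain ⟨s, rfl⟩ := Submodule.mem_span_singleton.1 hx
    apply Subtype.ext
    change a • s • e = 0
    rw [← mul_smul]
    exact h _ (Ideal.mul_mem_right s _ ha)
  have hss : IsSemisimpleModule R N := by
    let _ := hN.module
    exact hN.isSemisimpleModule_iff.1 inferInstance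
  obtain ⟨C, hC⟩ := exists_isCompl (X.comap N.subtype)
  have hC' : C = ⊥ := by
    rw [eq_bot_iff]
    intro c hc
    refine Subtype.ext (hE.2 c ((Submodule.span_singleton_le_iff_mem e E).2 he c.2) ?_)
    rw [eq_bot_iff]
    rintro x ⟨hx, hxX⟩
    obtain ⟨s, rfl⟩ := Submodule.mem_span_singleton.1 hx
    have : s • c ∈ X.comap N.subtype ⊓ C := ⟨hxX, C.smul_mem s hc⟩
    rw [hC.inf_eq_bot] at this
    exact congrArg Subtype.val this
  have htop := hC.sup_eq_top
  rw [hC', sup_bot_eq] at htop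
  have : (⟨e, Submodule.mem_span_singleton_self e⟩ : N) ∈ X.comap N.subtype :=
    htop ▸ Submodule.mem_top
  exact this

/-- The elements of `E` killed by the radical lie in `X`, which is finite over the noetherian ring
`k`; the radical filtration then makes all of `E` finite over `k`. -/
lemma IsEssentialExtension.finite (k : Type*) [CommRing k] [IsNoetherianRing k] [Algebra k R]
    [Module.Finite k R] [IsSemiprimaryRing R] (hE : IsEssentialExtension X E) (hX : X.FG) :
    Module.Finite R E := by
  let _ : Module k E := Module.compHom E (algebraMap k R)
  have : IsScalarTower k R E := ⟨fun c a x => by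
    rw [Algebra.smul_def, mul_smul]
    rfl⟩
  have hX' : ((X.comap E.subtype).restrictScalars k).FG := by
    refine Submodule.FG.restrictScalars ?_
    refine Submodule.fg_of_fg_map_injective E.subtype E.injective_subtype ?_
    rwa [Submodule.map_comap_subtype, inf_eq_right.2 hE.1]
  have := finite_of_fg_annihilated_jacobson k (R := R) (E := E) (hX'.of_le fun e he =>
    hE.mem_of_jacobson_smul_eq_zero e.2 fun a ha => congrArg Subtype.val (he a ha))
  exact Module.Finite.of_restrictScalars_finite k R E

end InjectiveEnvelope

/-! ### Enough projectives and injectives in `mod-Λ` -/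

section FGModules

variable (Λ : Type u) [Ring Λ] [IsArtinAlgebra Λ]

instance enoughProjectives_fgRightMod : EnoughProjectives (FGRightMod Λ) where
  presentation X := by
    obtain ⟨m, f, hf⟩ := Module.Finite.exists_fin' Λᵐᵒᵖ X
    let P : FGRightMod Λ := FGModuleCat.of Λᵐᵒᵖ (Fin m → Λᵐᵒᵖ)
    let F := forget₂ (FGRightMod Λ) (ModuleCat.{u} Λᵐᵒᵖ)
    have h₁ : Projective (F.obj P) :=
      (IsProjective.iff_projective (R := Λᵐᵒᵖ) (Fin m → Λᵐᵒᵖ)).1 inferInstance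
    have hP : Projective P := F.projective_of_map_projective h₁
    let p : P ⟶ X := FGModuleCat.ofHom f
    have h₂ : Epi (F.map p) := (ModuleCat.epi_iff_surjective _).2 hf
    exact ⟨{ p := P, projective := hP, f := p, epi := F.epi_of_epi_map h₂ }⟩

instance enoughInjectives_fgRightMod : EnoughInjectives (FGRightMod Λ) where
  presentation X := by
    obtain ⟨k, _, _, _, _⟩ := IsArtinAlgebra.exists_base (Λ := Λ)
    have : Module.Finite k Λᵐᵒᵖ := Module.Finite.equiv (MulOpposite.opLinearEquiv k)
    have : IsArtinianRing Λᵐᵒᵖ := isArtinian_of_tower k inferInstance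
    let F := forget₂ (FGRightMod Λ) (ModuleCat.{u} Λᵐᵒᵖ)
    let I : ModuleCat.{u} Λᵐᵒᵖ := Injective.under (F.obj X)
    let i : F.obj X ⟶ I := Injective.ι (F.obj X)
    have hi : Function.Injective i.hom := (ModuleCat.mono_iff_injective i).1 inferInstance
    have hI' : Injective I := Injective.injective_under _
    have hI : Module.Injective Λᵐᵒᵖ I :=
      Module.injective_module_of_injective_object Λᵐᵒᵖ I (inj := hI')
    have hX : (LinearMap.range i.hom).FG := by
      rw [LinearMap.range_eq_map]
      exact (Module.Finite.fg_top (R := Λᵐᵒᵖ) (M := X)).map i.hom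
    -- The ambient injective `I` may be too large; the hull of `X` inside it is both injective and
    -- finitely generated.
    obtain ⟨E, hE⟩ := exists_maximal_isEssentialExtension (LinearMap.range i.hom)
    have := hE.prop.finite k hX
    have := injective_of_maximal hE
    let J : FGRightMod Λ := FGModuleCat.of Λᵐᵒᵖ E
    have h₁ : Injective (F.obj J) := Module.injective_object_of_injective_module Λᵐᵒᵖ E
    have hJ : Injective J := F.injective_of_map_injective h₁
    let j : X ⟶ J := FGModuleCat.ofHom (i.hom.codRestrict E fun x => hE.prop.1 ⟨x, rfl⟩)
    have h₂ : Mono (F.map j) := (ModuleCat.mono_iff_injective _).2 fun x y hxy =>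
      hi (congrArg Subtype.val hxy)
    exact ⟨{ J := J, injective := hJ, f := j, mono := F.mono_of_mono_map h₂ }⟩

end FGModules

end HigherAuslander

end

open HigherAuslander in
theorem mainTheorem4 (Λ : Type u) [Ring Λ] [IsArtinAlgebra Λ] (n : ℕ) (hn : 1 ≤ n)
    (M : ObjectProperty (FGRightMod Λ)) (hM : IsNClusterTilting M n) :
    -- Theta is an additive, full, dense and objective functor
    ((Theta M).Additive ∧ (Theta M).Full ∧ (Theta M).EssSurj ∧ IsObjective (Theta M)) ∧
    -- the four categories are abelian
    (IsAbelianCategory (QuotientByIdeal (genV M)) ∧ IsAbelianCategory (StableRightMod M) ∧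
      IsAbelianCategory (StableLeftMod M)ᵒᵖ ∧ IsAbelianCategory (QuotientByIdeal (genV' M))) ∧
    -- monomorphisms and epimorphisms extend to n-exact sequences, functorially up to choices,
    -- so that the conditions IsPsi and IsPsi' determine a functor up to isomorphism
    ((firstMono hM.generating n).Full ∧ (firstMono hM.generating n).EssSurj ∧
      (lastEpi hM.cogenerating n).Full ∧ (lastEpi hM.cogenerating n).EssSurj) ∧
    -- the functors Psi, Psi' exist, and Psi, Theta, Psi' induce equivalences, which give the
    -- duality Sigma, the composite of Psi' with the inverse of Theta
    ∃ (Ψ : MonoCat M ⥤ StableRightMod M) (Ψ' : EpiCat M ⥤ (StableLeftMod M)ᵒᵖ)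
      (eΨ : QuotientByIdeal (genV M) ≌ StableRightMod M)
      (eΘ : QuotientByIdeal (genV' M) ≌ StableRightMod M)
      (eΨ' : QuotientByIdeal (genV' M) ≌ (StableLeftMod M)ᵒᵖ)
      (Sig : StableRightMod M ≌ (StableLeftMod M)ᵒᵖ),
      IsPsi hM.generating hM.cogenerating n Ψ ∧ IsPsi' hM.generating hM.cogenerating n Ψ' ∧
      Nonempty (toQuotient (genV M) ⋙ eΨ.functor ≅ Ψ) ∧
      Nonempty (toQuotient (genV' M) ⋙ eΘ.functor ≅ Theta M) ∧
      Nonempty (toQuotient (genV' M) ⋙ eΨ'.functor ≅ Ψ') ∧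
      Nonempty (Sig.functor ≅ eΘ.inverse ⋙ eΨ'.functor) :=
  main_of_enough hn hM
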